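/- **Model.** Two players, Al and Bob, have inputs $x,y\subseteq\{1,\dots,n\}$, and $DISJ_n(x,y)$ tells whether $x\cap y=\emptyset$. In a quantum protocol (no prior entanglement, no public coin) the players take turns; in his turn a player applies a unitary transformation, which may depend on his input, to the qubits he holds (private qubits initially in a fixed basis state, and the message just received), and then sends a prescribed number of his qubits to the other player. At the end measurements give the result to both players. The communication is the total number of qubits sent. The protocol has error $\varepsilon$ if on every input pair both players obtain the correct value with probability at least $1-\varepsilon$. **Privacy loss.** Instead of following the protocol, a player may use any sequence of quantum operations (with arbitrary additional private qubits) that is *honest*: for all inputs, every message he sends to the other player (who follows the protocol) has exactly the density matrix prescribed by the protocol. For a distribution $\mu$ of the inputs $(X,Y)$, the information divulged to such a Bob at time $t$ is $$I(B:X\mid Y,f(X,Y))=S(BYF)+S(XYF)-S(YF)-S(BXYF),\qquad F=f(X,Y),$$ where $f=DISJ_n$, $S$ is the von Neumann entropy (in bits), and $B$ consists of the qubits in Bob's hands after $t$ messages, when the inputs are distributed according to $\mu$; the information divulged to Al is defined symmetrically. The privacy loss of the protocol is the supremum of these quantities over both players, all distributions $\mu$, all times $t$ and all strategies that are honest up to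 time $t$ (so a player may quit early). **Theorem.** There is a constant $C$ such that for every $n\ge 2$ there is a quantum protocol that computes $DISJ_n$ with error $1/3$, communication at most $C\sqrt n\,\log_2 n$, and privacy loss at most $C\log_2^2 n$. -/

import Mathlib

open scoped Matrix Kronecker

noncomputable section

namespace QPrivacy

/-! ## Density matrices and entropy -/

/-- Basis labels of a register of `k` qubits. -/
abbrev Reg (k : ℕ) : Type := Fin k → Fin 2

section PartialTrace

variable {α β γ : Type} [Fintype α] [Fintype β] [Fintype γ]

/-- Trace out the first factor. -/
def trFst (ρ : Matrix (α × β) (α × β) ℂ) : Matrix β β ℂ :=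
  Matrix.of fun i j => ∑ a, ρ (a, i) (a, j)

/-- Trace out the second factor. -/
def trSnd (ρ : Matrix (α × β) (α × β) ℂ) : Matrix α α ℂ :=
  Matrix.of fun i j => ∑ b, ρ (i, b) (j, b)

/-- Trace out the middle factor. -/
def trMid (ρ : Matrix (α × β × γ) (α × β × γ) ℂ) : Matrix (α × γ) (α × γ) ℂ :=
  Matrix.of fun i j => ∑ b, ρ (i.1, b, i.2) (j.1, b, j.2)

/-- The von Neumann entropy `-∑ λ log₂ λ` over the multiset of eigenvalues (the roots of the
characteristic polynomial), in bits. -/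
def entropy [DecidableEq α] (ρ : Matrix α α ℂ) : ℝ :=
  (ρ.charpoly.roots.map fun z => -(z.re * Real.logb 2 z.re)).sum

/-- The conditional mutual information `I(R : S | C) = S(RC) + S(SC) - S(C) - S(RSC)` of a state
on `R ⊗ S ⊗ C`. -/
def condMutualInfo [DecidableEq α] [DecidableEq β] [DecidableEq γ]
    (ρ : Matrix (α × β × γ) (α × β × γ) ℂ) : ℝ :=
  entropy (trMid ρ) + entropy (trFst ρ) - entropy (trFst (trFst ρ)) - entropy ρ

end PartialTrace

/-! ## Operations -/

/-- A physically allowed operation (completely positive and trace preserving), in Kraus form. -/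
structure Channel (α β : Type) [Fintype α] [DecidableEq α] [Fintype β] where
  num : ℕ
  kraus : Fin num → Matrix β α ℂ
  complete : ∑ i, (kraus i)ᴴ * kraus i = 1

namespace Channel

variable {α β γ : Type} [Fintype α] [DecidableEq α] [Fintype β] [Fintype γ] [DecidableEq γ]

/-- Apply the operation to the first factor of a joint state. -/
def act (T : Channel α β) (ρ : Matrix (α × γ) (α × γ) ℂ) : Matrix (β × γ) (β × γ) ℂ :=
  ∑ i, (T.kraus i ⊗ₖ (1 : Matrix γ γ ℂ)) * ρ * (T.kraus i ⊗ₖ (1 : Matrix γ γ ℂ))ᴴ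

/-- The operation is `ρ ↦ V ρ Vᴴ` with `Vᴴ V = 1`. On qubit registers this is: append blank
qubits, then apply a unitary transformation. -/
def IsUnitary (T : Channel α β) : Prop := T.num = 1

end Channel

/-! ## Two-party runs -/

/-- What a player with input in `I` does in each of his turns. In turn `k` he holds `priv k`
private qubits and the `qin k` qubits of the message just received; he applies an operation, keeps
`priv (k + 1)` qubits and sends `qout k` qubits. -/
structure Strategy (I : Type) (qin qout : ℕ → ℕ) where
  priv : ℕ → ℕ
  op : (k : ℕ) → I →
    Channel (Reg (priv k) × Reg (qin k)) (Reg (priv (k + 1)) × Reg (qout k))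

/-- Hand the message over: (sender, message, receiver) becomes (receiver, message, sender). -/
def pass {P M O : Type} (ρ : Matrix ((P × M) × O) ((P × M) × O) ℂ) :
    Matrix ((O × M) × P) ((O × M) × P) ℂ :=
  ρ.submatrix (fun i => ((i.2, i.1.2), i.1.1)) (fun i => ((i.2, i.1.2), i.1.1))

section Run

variable {X Y : Type} {qA qB : ℕ → ℕ}

/-- The joint state on inputs `x, y` when each player has completed `k` turns, in the order
(Al's private qubits, Bob's last message, Bob's private qubits); the message is in Al's hands.
All qubits start in the state `|0⟩`. The `k`-th message of Al has `qA k` qubits, and the reply of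
Bob to it has `qB (k + 1)` qubits. -/
def run (A : Strategy X qB qA) (B : Strategy Y qA fun k => qB (k + 1)) (x : X) (y : Y) :
    (k : ℕ) → Matrix ((Reg (A.priv k) × Reg (qB k)) × Reg (B.priv k))
      ((Reg (A.priv k) × Reg (qB k)) × Reg (B.priv k)) ℂ
  | 0 => Matrix.single 0 0 1
  | k + 1 => pass ((B.op k y).act (pass ((A.op k x).act (run A B x y k))))

/-- The joint state when Al has completed `k + 1` turns and Bob `k` turns, in the order
(Bob's private qubits, Al's last message, Al's private qubits); the message is in Bob's hands. -/
def runMid (A : Strategy X qB qA) (B : Strategy Y qA fun k => qB (k + 1)) (x : X) (y : Y) (k : ℕ) :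
    Matrix ((Reg (B.priv k) × Reg (qA k)) × Reg (A.priv (k + 1)))
      ((Reg (B.priv k) × Reg (qA k)) × Reg (A.priv (k + 1))) ℂ :=
  pass ((A.op k x).act (run A B x y k))

/-- Density matrix of the message that Al sends in his turn `k`. -/
def msgAl (A : Strategy X qB qA) (B : Strategy Y qA fun k => qB (k + 1)) (x : X) (y : Y) (k : ℕ) :
    Matrix (Reg (qA k)) (Reg (qA k)) ℂ :=
  trFst (trSnd (runMid A B x y k))

/-- Density matrix of the message that Bob sends in his turn `k`. -/
def msgBob (A : Strategy X qB qA) (B : Strategy Y qA fun k => qB (k + 1)) (x : X) (y : Y) (k : ℕ) :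
    Matrix (Reg (qB (k + 1))) (Reg (qB (k + 1))) ℂ :=
  trFst (trSnd (run A B x y (k + 1)))

end Run

/-! ## Quantum protocols -/

/-- A quantum protocol without prior entanglement and without public coin. The players alternate,
Al moves first (possibly with an empty message); each of them has `rounds` turns. Private qubits
start in `|0⟩`; the operations are unitary, and measurements are made at the end: both players then
measure the qubits they hold in the standard basis and read off the result. -/
structure Protocol (X Y Z : Type) where
  rounds : ℕ
  qA : ℕ → ℕ
  qB : ℕ → ℕ
  qB_zero : qB 0 = 0
  al : Strategy X qB qA
  bob : Strategy Y qA fun k => qB (k + 1)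
  al_unitary : ∀ k x, (al.op k x).IsUnitary
  bob_unitary : ∀ k y, (bob.op k y).IsUnitary
  outAl : Reg (al.priv rounds) × Reg (qB rounds) → Z
  outBob : Reg (bob.priv rounds) → Z

/-- The classical-quantum state `∑ μ(x,y) σ_{xy} ⊗ |x⟩⟨x| ⊗ |y, f(x,y)⟩⟨y, f(x,y)|`. -/
def cqState {X Y Z R : Type} [Fintype X] [DecidableEq X] [Fintype Y] [DecidableEq Y]
    [DecidableEq Z] (f : X → Y → Z) (μ : X × Y → ℝ) (σ : X → Y → Matrix R R ℂ) :
    Matrix (R × X × (Y × Z)) (R × X × (Y × Z)) ℂ :=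
  ∑ x, ∑ y, (μ (x, y) : ℂ) • (σ x y ⊗ₖ
    (Matrix.single x x (1 : ℂ) ⊗ₖ Matrix.single (y, f x y) (y, f x y) (1 : ℂ)))

/-- `I(R : X | Y, f(X,Y))` when the inputs have distribution `μ` and the register `R` is in the
state `σ x y` on inputs `x, y`. -/
def divulged {X Y Z R : Type} [Fintype X] [DecidableEq X] [Fintype Y] [DecidableEq Y]
    [Fintype Z] [DecidableEq Z] [Fintype R] [DecidableEq R]
    (f : X → Y → Z) (μ : X × Y → ℝ) (σ : X → Y → Matrix R R ℂ) : ℝ :=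
  condMutualInfo (cqState f μ σ)

namespace Protocol

variable {X Y Z : Type}

/-- The number of qubits exchanged. -/
def communication (P : Protocol X Y Z) : ℕ :=
  ∑ k ∈ Finset.range P.rounds, (P.qA k + P.qB (k + 1))

open Classical in
/-- On inputs `x, y`, the probability that both players output `z`. -/
def outputProb (P : Protocol X Y Z) (x : X) (y : Y) (z : Z) : ℝ :=
  ∑ i, if P.outAl i.1 = z ∧ P.outBob i.2 = z then (run P.al P.bob x y P.rounds i i).re else 0

/-- `P` computes `f` with error `ε`. -/
def Computes (P : Protocol X Y Z) (f : X → Y → Z) (ε : ℝ) : Prop :=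
  ∀ x y, 1 - ε ≤ P.outputProb x y (f x y)

/-- A strategy of Al is honest during his first `k` turns: whatever the inputs are, against a Bob
who follows the protocol, each message that Al sends has the density matrix that the protocol
prescribes. Every operation that respects this is allowed. -/
def HonestAl (P : Protocol X Y Z) (A : Strategy X P.qB P.qA) (k : ℕ) : Prop :=
  ∀ x y, ∀ j < k, msgAl A P.bob x y j = msgAl P.al P.bob x y j

/-- A strategy of Bob is honest during his first `k` turns. -/
def HonestBob (P : Protocol X Y Z) (B : Strategy Y P.qA fun k => P.qB (k + 1)) (k : ℕ) : Prop :=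
  ∀ x y, ∀ j < k, msgBob P.al B x y j = msgBob P.al P.bob x y j

variable [Fintype X] [DecidableEq X] [Fintype Y] [DecidableEq Y] [Fintype Z] [DecidableEq Z]

/-- The privacy loss of `P`, as a protocol for `f`, is at most `δ`: for every distribution of the
inputs, every strategy of one player against the other one following the protocol, and every point
of time (after any number of messages) up to which the strategy is honest, the qubits in the
player's hands, which include the message just received, give at most `δ` bits of information
about the other player's input beyond his own input and the value of `f`. -/
def PrivacyLossLE (P : Protocol X Y Z) (f : X → Y → Z) (δ : ℝ) : Prop :=
  ∀ μ ∈ stdSimplex ℝ (X × Y),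
    (∀ A : Strategy X P.qB P.qA, ∀ k,
      (k ≤ P.rounds → P.HonestAl A k →
        divulged (fun y x => f x y) (fun p => μ p.swap)
          (fun y x => trSnd (run A P.bob x y k)) ≤ δ) ∧
      (k < P.rounds → P.HonestAl A (k + 1) →
        divulged (fun y x => f x y) (fun p => μ p.swap)
          (fun y x => trFst (runMid A P.bob x y k)) ≤ δ)) ∧
    (∀ B : Strategy Y P.qA fun k => P.qB (k + 1), ∀ k,
      (k ≤ P.rounds → P.HonestBob B k →
        divulged f μ (fun x y => trFst (run P.al B x y k)) ≤ δ) ∧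
      (k < P.rounds → P.HonestBob B k →
        divulged f μ (fun x y => trSnd (runMid P.al B x y k)) ≤ δ))

end Protocol

/-- Set disjointness on subsets of an `n`-element universe. -/
def disj (n : ℕ) (x y : Finset (Fin n)) : Bool := decide (Disjoint x y)

end QPrivacy

end

/-!
Al and Bob run Grover's search for a common element of their sets, sending a register of
`q = O(log n)` qubits to and fro `O(√n)` times. All messages but the last one are pure states. Bob
marks the common elements by a phase `ω` instead of `-1`. At `ω = 1` he does nothing, so that the
states he may receive on different inputs of Al are those of the membership oracle, which are
orthogonal only for complementary sets; an index outside of all sets excludes this. Since inner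
products are analytic in the argument of `ω`, for all but isolated `ω` no two states which a player
may receive are orthogonal. Such an `ω` can be chosen so close to `-1` that the search still
succeeds with probability more than `3/7`, and two copies in parallel succeed with probability more
than `1 - (4/7)² > 2/3`.

A player is honest only if he turns nonorthogonal pure states into pure states with the same inner
products. Then he is left with a private state that does not depend on the other player's input, so
that all he ever learns about it is in the single message he holds. A message of `q` qubits divulges
at most `q` bits, because a private state `σ` and any message are dominated by `2 ^ q` times `σ` and
the maximally mixed message.
-/

noncomputable section

namespace QPrivacy

open scoped ComplexOrder

/-! ### Entropy -/

section Entropy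

variable {α β : Type} [Fintype α] [DecidableEq α] [Fintype β] [DecidableEq β]

lemma neg_mul_logb_two (a : ℝ) : -(a * Real.logb 2 a) = Real.negMulLog a / Real.log 2 := by
  rw [Real.negMulLog, Real.logb]
  ring

lemma entropy_eq_sum_negMulLog {A : Matrix α α ℂ} (hA : A.IsHermitian) :
    entropy A = (∑ i, Real.negMulLog (hA.eigenvalues i)) / Real.log 2 := by
  simp only [entropy, hA.roots_charpoly_eq_eigenvalues, Multiset.map_map, Finset.sum_div,
    neg_mul_logb_two]
  rfl

lemma entropy_diagonal (d : α → ℝ) :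
    entropy (Matrix.diagonal fun i => (d i : ℂ)) =
      (∑ i, Real.negMulLog (d i)) / Real.log 2 := by
  rw [entropy, Matrix.charpoly_diagonal, Polynomial.roots_prod _ _
    (Finset.prod_ne_zero_iff.2 fun i _ => Polynomial.X_sub_C_ne_zero _)]
  simp only [Polynomial.roots_X_sub_C, Multiset.bind_singleton, Multiset.map_map, Finset.sum_div,
    neg_mul_logb_two]
  rfl

lemma charpoly_blockDiagonal (M : β → Matrix α α ℂ) :
    (Matrix.blockDiagonal M).charpoly = ∏ b, (M b).charpoly := by
  have h : (Matrix.blockDiagonal M).charmatrix =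
      Matrix.blockDiagonal fun b => (M b).charmatrix := by
    ext ⟨i, b⟩ ⟨j, c⟩
    by_cases hb : b = c
    · by_cases hi : i = j <;> simp [Matrix.charmatrix, Matrix.blockDiagonal_apply, hb, hi]
    · simp [Matrix.blockDiagonal_apply, hb]
  rw [Matrix.charpoly, h, Matrix.det_blockDiagonal]
  rfl

lemma entropy_blockDiagonal (M : β → Matrix α α ℂ) :
    entropy (Matrix.blockDiagonal M) = ∑ b, entropy (M b) := by
  rw [entropy, charpoly_blockDiagonal, Polynomial.roots_prod _ _
    (Finset.prod_ne_zero_iff.2 fun i _ => (Matrix.charpoly_monic _).ne_zero),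
    Multiset.map_bind, Multiset.sum_bind]
  rfl

end Entropy

section Kernel

variable {ι κ : Type*} [Fintype ι] [Fintype κ] {a : ι → ℝ} {b : κ → ℝ} {G : ι → κ → ℝ}

lemma log_sub_log_le {a b : ℝ} (ha : 0 < a) (hb : 0 < b) :
    Real.log b - Real.log a ≤ b / a - 1 := by
  rw [← Real.log_div hb.ne' ha.ne']
  exact Real.log_le_sub_one_of_pos (div_pos hb ha)

lemma sum_negMulLog_le_neg_sum_mul_log (ha : ∀ i, 0 ≤ a i) (hb : ∀ j, 0 ≤ b j)
    (hG : ∀ i j, 0 ≤ G i j) (hrow : ∀ i, ∑ j, G i j = 1) (hcol : ∀ j, ∑ i, G i j = 1)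
    (hab : ∑ j, b j = ∑ i, a i) (h : ∀ i j, b j = 0 → a i * G i j = 0) :
    ∑ i, Real.negMulLog (a i) ≤ -∑ i, ∑ j, a i * G i j * Real.log (b j) := by
  have key (i j) : a i * G i j * (Real.log (b j) - Real.log (a i)) ≤ G i j * (b j - a i) := by
    rcases (ha i).eq_or_lt with hi | hi
    · simpa [← hi] using mul_nonneg (hG i j) (hb j)
    rcases (hb j).eq_or_lt with hj | hj
    · have hGij : G i j = 0 := (mul_eq_zero.1 (h i j hj.symm)).resolve_left hi.ne'
      simp [hGij]
    calc a i * G i j * (Real.log (b j) - Real.log (a i))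
        ≤ a i * G i j * (b j / a i - 1) :=
          mul_le_mul_of_nonneg_left (log_sub_log_le hi hj) (mul_nonneg hi.le (hG i j))
      _ = G i j * (b j - a i) := by field_simp
  have hright : ∑ i, ∑ j, G i j * (b j - a i) = 0 := by
    simp only [mul_sub, Finset.sum_sub_distrib]
    rw [Finset.sum_comm]
    simp only [← Finset.sum_mul, hrow, hcol, one_mul, hab, sub_self]
  have hleft : ∑ i, ∑ j, a i * G i j * (Real.log (b j) - Real.log (a i)) =
      ∑ i, ∑ j, a i * G i j * Real.log (b j) + ∑ i, Real.negMulLog (a i) := by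
    simp only [mul_sub, Finset.sum_sub_distrib, ← Finset.sum_mul, ← Finset.mul_sum, hrow, mul_one,
      Real.negMulLog, neg_mul, Finset.sum_neg_distrib, ← sub_eq_add_neg]
  linarith [Finset.sum_le_sum fun i (_ : i ∈ Finset.univ) =>
    Finset.sum_le_sum fun j (_ : j ∈ Finset.univ) => key i j]

lemma neg_sum_mul_log_le_sum_negMulLog (ha : ∀ i, 0 ≤ a i) (hb : ∀ j, 0 ≤ b j)
    (hG : ∀ i j, 0 ≤ G i j) (hrow : ∀ i, ∑ j, G i j = 1)
    (h : ∀ i j, b j = 0 → a i * G i j = 0) (hab : ∀ i, a i * ∑ j, G i j / b j ≤ 1) :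
    -∑ i, ∑ j, a i * G i j * Real.log (b j) ≤ ∑ i, Real.negMulLog (a i) := by
  rw [← Finset.sum_neg_distrib]
  refine Finset.sum_le_sum fun i _ => ?_
  have key (j) : a i * G i j * (Real.log (a i) - Real.log (b j)) ≤
      a i * (a i * (G i j / b j) - G i j) := by
    rcases (ha i).eq_or_lt with hi | hi
    · simp [← hi]
    rcases (hb j).eq_or_lt with hj | hj
    · have hGij : G i j = 0 := (mul_eq_zero.1 (h i j hj.symm)).resolve_left hi.ne'
      simp [hGij]
    calc a i * G i j * (Real.log (a i) - Real.log (b j))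
        ≤ a i * G i j * (a i / b j - 1) :=
          mul_le_mul_of_nonneg_left (log_sub_log_le hj hi) (mul_nonneg hi.le (hG i j))
      _ = a i * (a i * (G i j / b j) - G i j) := by ring
  have hsum := Finset.sum_le_sum fun j (_ : j ∈ Finset.univ) => key j
  simp only [mul_sub, Finset.sum_sub_distrib, ← Finset.sum_mul, ← Finset.mul_sum, hrow,
    mul_one] at hsum
  have hle : a i * (a i * ∑ j, G i j / b j) ≤ a i := mul_le_of_le_one_right (ha i) (hab i)
  rw [Real.negMulLog]
  linarith

lemma sum_mul_log_mul {c : ℝ} (hrow : ∀ i, ∑ j, G i j = 1)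
    (h : ∀ i j, c * b j = 0 → a i * G i j = 0) :
    ∑ i, ∑ j, a i * G i j * Real.log (c * b j) =
      (∑ i, a i) * Real.log c + ∑ i, ∑ j, a i * G i j * Real.log (b j) := by
  have hlog (i j) : a i * G i j * Real.log (c * b j) =
      a i * G i j * Real.log c + a i * G i j * Real.log (b j) := by
    by_cases hcb : c * b j = 0
    · simp [h i j hcb]
    · rw [Real.log_mul (left_ne_zero_of_mul hcb) (right_ne_zero_of_mul hcb), mul_add]
  simp only [hlog, Finset.sum_add_distrib, ← Finset.sum_mul, ← Finset.mul_sum, hrow, mul_one]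

end Kernel

section Domination

variable {ι κ : Type*} [Fintype ι] [DecidableEq ι] [DecidableEq κ]

lemma star_dotProduct_diagonal_mulVec (d : ι → ℝ) (v : ι → ℂ) :
    star v ⬝ᵥ (Matrix.diagonal (fun i => (d i : ℂ)) *ᵥ v) =
      ((∑ i, d i * Complex.normSq (v i) : ℝ) : ℂ) := by
  simp only [dotProduct, Matrix.mulVec_diagonal, Pi.star_apply, Complex.star_def,
    Complex.ofReal_sum, Complex.ofReal_mul, Complex.normSq_eq_conj_mul_self]
  exact Finset.sum_congr rfl fun i _ => by ring

variable {a : ι → ℝ} {b : κ → ℝ} {Q : Matrix κ ι ℂ}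

lemma sum_mul_normSq_mulVec_le [Fintype κ]
    (h : (Matrix.diagonal (fun j => (b j : ℂ)) -
      Q * Matrix.diagonal (fun i => (a i : ℂ)) * Qᴴ).PosSemidef) (v : κ → ℂ) :
    ∑ i, a i * Complex.normSq ((Qᴴ *ᵥ v) i) ≤ ∑ j, b j * Complex.normSq (v j) := by
  have hconj : star v ⬝ᵥ ((Q * Matrix.diagonal (fun i => (a i : ℂ)) * Qᴴ) *ᵥ v) =
      star (Qᴴ *ᵥ v) ⬝ᵥ (Matrix.diagonal (fun i => (a i : ℂ)) *ᵥ (Qᴴ *ᵥ v)) := by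
    rw [← Matrix.mulVec_mulVec, ← Matrix.mulVec_mulVec, Matrix.dotProduct_mulVec,
      Matrix.star_mulVec, Matrix.conjTranspose_conjTranspose]
  have hnonneg := h.re_dotProduct_nonneg v
  rw [Matrix.sub_mulVec, dotProduct_sub, hconj, star_dotProduct_diagonal_mulVec,
    star_dotProduct_diagonal_mulVec, ← Complex.ofReal_sub] at hnonneg
  exact sub_nonneg.1 hnonneg

lemma sum_mul_normSq_le_of_dominated
    (h : (Matrix.diagonal (fun j => (b j : ℂ)) -
      Q * Matrix.diagonal (fun i => (a i : ℂ)) * Qᴴ).PosSemidef) (j : κ) :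
    ∑ i, a i * Complex.normSq (Q j i) ≤ b j := by
  have hdiag := h.diag_nonneg (i := j)
  have hentry : (Q * Matrix.diagonal (fun i => (a i : ℂ)) * Qᴴ) j j =
      ((∑ i, a i * Complex.normSq (Q j i) : ℝ) : ℂ) := by
    rw [Matrix.mul_apply]
    simp only [Matrix.mul_diagonal, Matrix.conjTranspose_apply, Complex.star_def,
      Complex.ofReal_sum, Complex.ofReal_mul, ← Complex.mul_conj]
    exact Finset.sum_congr rfl fun i _ => by ring
  rw [Matrix.sub_apply, Matrix.diagonal_apply_eq, hentry, ← Complex.ofReal_sub,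
    Complex.zero_le_real] at hdiag
  exact sub_nonneg.1 hdiag

lemma mul_sum_normSq_div_le_one_of_dominated [Fintype κ] (ha : ∀ i, 0 ≤ a i) (hb : ∀ j, 0 ≤ b j)
    (h : (Matrix.diagonal (fun j => (b j : ℂ)) -
      Q * Matrix.diagonal (fun i => (a i : ℂ)) * Qᴴ).PosSemidef) (i : ι) :
    a i * ∑ j, Complex.normSq (Q j i) / b j ≤ 1 := by
  set s := ∑ j, Complex.normSq (Q j i) / b j with hs
  have hs0 : 0 ≤ s := Finset.sum_nonneg fun j _ => div_nonneg (Complex.normSq_nonneg _) (hb j)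
  have hright : ∑ j, b j * Complex.normSq (Q j i / (b j : ℂ)) = s :=
    Finset.sum_congr rfl fun j _ => by
      rw [Complex.normSq_div, Complex.normSq_ofReal]
      rcases eq_or_ne (b j) 0 with hj | hj
      · simp [hj]
      · field_simp
  have hleft : (Qᴴ *ᵥ fun j => Q j i / (b j : ℂ)) i = s := by
    simp only [Matrix.mulVec, dotProduct, Matrix.conjTranspose_apply, Complex.star_def, hs,
      Complex.ofReal_sum, Complex.ofReal_div, Complex.normSq_eq_conj_mul_self, mul_div_assoc]
  have hle : a i * (s * s) ≤ s := by
    rw [← Complex.normSq_ofReal, ← hleft]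
    refine (Finset.single_le_sum
      (f := fun k => a k * Complex.normSq ((Qᴴ *ᵥ fun j => Q j i / (b j : ℂ)) k))
      (fun k _ => mul_nonneg (ha k) (Complex.normSq_nonneg _)) (Finset.mem_univ i)).trans ?_
    exact (sum_mul_normSq_mulVec_le h _).trans_eq hright
  rcases hs0.eq_or_lt with h0 | h0
  · simp [← h0]
  · exact le_of_mul_le_mul_right (by linarith) h0

end Domination

/-! ### A Holevo bound -/

section Holevo

variable {α : Type} [Fintype α] [DecidableEq α]

lemma sum_normSq_col (Q : Matrix.unitaryGroup α ℂ) (i : α) :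
    ∑ j, Complex.normSq ((Q : Matrix α α ℂ) j i) = 1 := by
  have h := congrFun₂ (Matrix.UnitaryGroup.star_mul_self Q) i i
  rw [Matrix.star_eq_conjTranspose, Matrix.mul_apply, Matrix.one_apply_eq] at h
  simp only [Matrix.conjTranspose_apply, Complex.star_def, ← Complex.normSq_eq_conj_mul_self] at h
  exact_mod_cast h

lemma sum_normSq_row (Q : Matrix.unitaryGroup α ℂ) (i : α) :
    ∑ j, Complex.normSq ((Q : Matrix α α ℂ) i j) = 1 := by
  simpa [Matrix.star_apply] using sum_normSq_col (star Q) i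

/-- The unitary matrix that expresses the eigenvectors of `W` in the eigenbasis of `τ`. -/
def eigenbasisChange {W τ : Matrix α α ℂ} (hW : W.IsHermitian) (hτ : τ.IsHermitian) :
    Matrix.unitaryGroup α ℂ :=
  star hτ.eigenvectorUnitary * hW.eigenvectorUnitary

/-- The cross entropy `-Tr (W ln τ)`, in nats. The kernel of `τ` contributes nothing to it, because
`Real.log 0 = 0`. -/
def crossEntropy {τ : Matrix α α ℂ} (hτ : τ.IsHermitian) (W : Matrix α α ℂ) : ℝ :=
  -∑ j, (((hτ.eigenvectorUnitary : Matrix α α ℂ)ᴴ * W *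
    (hτ.eigenvectorUnitary : Matrix α α ℂ)) j j).re * Real.log (hτ.eigenvalues j)

lemma crossEntropy_sum {ι : Type*} (s : Finset ι) {τ : Matrix α α ℂ} (hτ : τ.IsHermitian)
    (W : ι → Matrix α α ℂ) :
    crossEntropy hτ (∑ x ∈ s, W x) = ∑ x ∈ s, crossEntropy hτ (W x) := by
  simp only [crossEntropy, Finset.mul_sum, Finset.sum_mul, Matrix.sum_apply, Complex.re_sum,
    Finset.sum_neg_distrib]
  rw [Finset.sum_comm]

variable {W τ : Matrix α α ℂ}

lemma conj_eigenvectorUnitary_eq (hW : W.IsHermitian) (hτ : τ.IsHermitian) :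
    (hτ.eigenvectorUnitary : Matrix α α ℂ)ᴴ * W * (hτ.eigenvectorUnitary : Matrix α α ℂ) =
      (eigenbasisChange hW hτ : Matrix α α ℂ) *
        Matrix.diagonal (fun i => (hW.eigenvalues i : ℂ)) *
      (eigenbasisChange hW hτ : Matrix α α ℂ)ᴴ := by
  conv_lhs => rw [hW.spectral_theorem, Unitary.conjStarAlgAut_apply]
  simp only [eigenbasisChange, Submonoid.coe_mul, Unitary.coe_star, Matrix.star_eq_conjTranspose,
    Matrix.conjTranspose_mul, Matrix.conjTranspose_conjTranspose, Matrix.mul_assoc]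
  rfl

lemma eigenbasisChange_self (hτ : τ.IsHermitian) : eigenbasisChange hτ hτ = 1 :=
  Unitary.star_mul_self hτ.eigenvectorUnitary

lemma posSemidef_diagonal_sub (hW : W.IsHermitian) (hτ : τ.IsHermitian) {c : ℝ}
    (h : ((c : ℂ) • τ - W).PosSemidef) :
    (Matrix.diagonal (fun j => ((c * hτ.eigenvalues j : ℝ) : ℂ)) -
      (eigenbasisChange hW hτ : Matrix α α ℂ) *
        Matrix.diagonal (fun i => (hW.eigenvalues i : ℂ)) *
      (eigenbasisChange hW hτ : Matrix α α ℂ)ᴴ).PosSemidef := by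
  have hconj := h.conjTranspose_mul_mul_same (hτ.eigenvectorUnitary : Matrix α α ℂ)
  rw [Matrix.mul_sub, Matrix.sub_mul, Matrix.mul_smul, Matrix.smul_mul,
    conj_eigenvectorUnitary_eq hW hτ, conj_eigenvectorUnitary_eq hτ hτ, eigenbasisChange_self,
    Submonoid.coe_one, Matrix.conjTranspose_one, Matrix.mul_one, Matrix.one_mul] at hconj
  convert hconj using 2
  rw [← Matrix.diagonal_smul]
  congr 1
  ext j
  simp

lemma crossEntropy_eq_neg_sum (hW : W.IsHermitian) (hτ : τ.IsHermitian) :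
    crossEntropy hτ W = -∑ i, ∑ j, hW.eigenvalues i *
      Complex.normSq ((eigenbasisChange hW hτ : Matrix α α ℂ) j i) *
        Real.log (hτ.eigenvalues j) := by
  rw [crossEntropy, Finset.sum_comm, conj_eigenvectorUnitary_eq hW hτ]
  congr 1
  refine Finset.sum_congr rfl fun j _ => ?_
  rw [← Finset.sum_mul, Matrix.mul_apply, Complex.re_sum]
  congr 1
  refine Finset.sum_congr rfl fun i _ => ?_
  rw [Matrix.mul_diagonal, Matrix.conjTranspose_apply, Complex.star_def, mul_right_comm,
    Complex.mul_conj, ← Complex.ofReal_mul, Complex.ofReal_re, mul_comm]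

lemma sum_eigenvalues_eq (hW : W.IsHermitian) {q : ℝ} (hq : W.trace = q) :
    ∑ i, hW.eigenvalues i = q := by
  rw [hW.trace_eq_sum_eigenvalues] at hq
  simpa using congrArg Complex.re hq

lemma eigenvalue_mul_normSq_eq_zero (hW : W.PosSemidef) (hτ : τ.IsHermitian) {c : ℝ}
    (h : ((c : ℂ) • τ - W).PosSemidef) (i : α) {j : α} (hj : c * hτ.eigenvalues j = 0) :
    hW.1.eigenvalues i *
      Complex.normSq ((eigenbasisChange hW.1 hτ : Matrix α α ℂ) j i) = 0 := by
  have hnonneg (i) : 0 ≤ hW.1.eigenvalues i *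
      Complex.normSq ((eigenbasisChange hW.1 hτ : Matrix α α ℂ) j i) :=
    mul_nonneg (hW.eigenvalues_nonneg i) (Complex.normSq_nonneg _)
  have hle := sum_mul_normSq_le_of_dominated (posSemidef_diagonal_sub hW.1 hτ h) j
  exact (Finset.sum_eq_zero_iff_of_nonneg fun i _ => hnonneg i).1
    ((hle.trans_eq hj).antisymm (Finset.sum_nonneg fun i _ => hnonneg i)) i (Finset.mem_univ i)

lemma sum_negMulLog_le_crossEntropy (hW : W.PosSemidef) (hτ : τ.PosSemidef) {c q : ℝ}
    (h : ((c : ℂ) • τ - W).PosSemidef) (hq : W.trace = q) (hτ1 : τ.trace = 1) :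
    ∑ i, Real.negMulLog (hW.1.eigenvalues i) ≤ Real.negMulLog q + crossEntropy hτ.1 W := by
  have hsum := sum_eigenvalues_eq hW.1 hq
  have hq0 : 0 ≤ q := hsum ▸ Finset.sum_nonneg fun i _ => hW.eigenvalues_nonneg i
  have hsupport (i j) (hj : q * hτ.1.eigenvalues j = 0) : hW.1.eigenvalues i *
      Complex.normSq ((eigenbasisChange hW.1 hτ.1 : Matrix α α ℂ) j i) = 0 := by
    rcases mul_eq_zero.1 hj with hq' | hj
    · have hi := (Finset.sum_eq_zero_iff_of_nonneg fun i _ => hW.eigenvalues_nonneg i).1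
        (hsum.trans hq') i (Finset.mem_univ i)
      rw [hi, zero_mul]
    · exact eigenvalue_mul_normSq_eq_zero hW hτ.1 h i (by rw [hj, mul_zero])
  have hgibbs := sum_negMulLog_le_neg_sum_mul_log hW.eigenvalues_nonneg
    (fun j => mul_nonneg hq0 (hτ.eigenvalues_nonneg j)) (fun _ _ => Complex.normSq_nonneg _)
    (sum_normSq_col (eigenbasisChange hW.1 hτ.1)) (sum_normSq_row (eigenbasisChange hW.1 hτ.1))
    (by rw [← Finset.mul_sum, sum_eigenvalues_eq hτ.1 (q := 1) (by simpa using hτ1), mul_one, hsum])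
    hsupport
  rw [sum_mul_log_mul (sum_normSq_col _) hsupport, hsum] at hgibbs
  rw [crossEntropy_eq_neg_sum hW.1, Real.negMulLog]
  linarith

lemma crossEntropy_le_sum_negMulLog (hW : W.PosSemidef) (hτ : τ.PosSemidef) {c q : ℝ} (hc : 0 ≤ c)
    (h : ((c : ℂ) • τ - W).PosSemidef) (hq : W.trace = q) :
    crossEntropy hτ.1 W ≤ ∑ i, Real.negMulLog (hW.1.eigenvalues i) + q * Real.log c := by
  have hb (j) : 0 ≤ c * hτ.1.eigenvalues j := mul_nonneg hc (hτ.eigenvalues_nonneg j)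
  have hsupport (i j) := eigenvalue_mul_normSq_eq_zero hW hτ.1 h i (j := j)
  have hratio := neg_sum_mul_log_le_sum_negMulLog hW.eigenvalues_nonneg hb
    (fun _ _ => Complex.normSq_nonneg _) (sum_normSq_col (eigenbasisChange hW.1 hτ.1)) hsupport
    (mul_sum_normSq_div_le_one_of_dominated hW.eigenvalues_nonneg hb
      (posSemidef_diagonal_sub hW.1 hτ.1 h))
  rw [sum_mul_log_mul (sum_normSq_col _) hsupport, sum_eigenvalues_eq hW.1 hq] at hratio
  rw [crossEntropy_eq_neg_sum hW.1]
  linarith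

lemma mul_log_mul_eq (p : ℝ) {D : ℝ} (hD : D ≠ 0) :
    p * Real.log (p * D) = -Real.negMulLog p + p * Real.log D := by
  rcases eq_or_ne p 0 with rfl | hp
  · simp
  · rw [Real.log_mul hp hD, Real.negMulLog]
    ring

lemma holevo_bound_of_dominated {ι : Type*} [Fintype ι] {W : ι → Matrix α α ℂ} {p : ι → ℝ} {D : ℝ}
    (hD : 0 < D) (hW : ∀ x, (W x).PosSemidef) (hτ : τ.PosSemidef) (hτ1 : τ.trace = 1)
    (hp : ∀ x, (W x).trace = p x) (h : ∀ x, (((p x * D : ℝ) : ℂ) • τ - W x).PosSemidef) :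
    entropy (∑ x, W x) + (∑ x, Real.negMulLog (p x)) / Real.log 2 ≤
      (∑ x, entropy (W x)) + Real.negMulLog (∑ x, p x) / Real.log 2 +
        (∑ x, p x) * Real.logb 2 D := by
  have hp0 (x) : 0 ≤ p x := Complex.zero_le_real.1 (hp x ▸ (hW x).trace_nonneg)
  have hS : (∑ x, W x).PosSemidef := Matrix.posSemidef_sum _ fun x _ => hW x
  have hdom : (((∑ x, p x * D : ℝ) : ℂ) • τ - ∑ x, W x).PosSemidef := by
    have := Matrix.posSemidef_sum Finset.univ fun x _ => h x
    rwa [Finset.sum_sub_distrib, ← Finset.sum_smul, ← Complex.ofReal_sum] at this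
  have htotal := sum_negMulLog_le_crossEntropy hS hτ (q := ∑ x, p x) hdom
    (by rw [Matrix.trace_sum]; simp [hp]) hτ1
  have hmember (x) : crossEntropy hτ.1 (W x) ≤ ∑ i, Real.negMulLog ((hW x).1.eigenvalues i) +
      (-Real.negMulLog (p x) + p x * Real.log D) :=
    (crossEntropy_le_sum_negMulLog (hW x) hτ (mul_nonneg (hp0 x) hD.le) (h x) (hp x)).trans_eq
      (by rw [mul_log_mul_eq _ hD.ne'])
  have hmembers := Finset.sum_le_sum fun x (_ : x ∈ Finset.univ) => hmember x
  simp only [Finset.sum_add_distrib, Finset.sum_neg_distrib, ← Finset.sum_mul] at hmembers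
  rw [crossEntropy_sum] at htotal
  rw [entropy_eq_sum_negMulLog hS.1,
    Finset.sum_congr rfl fun x _ => entropy_eq_sum_negMulLog (hW x).1,
    ← Finset.sum_div, Real.logb, ← mul_div_assoc, ← add_div, ← add_div, ← add_div]
  refine div_le_div_of_nonneg_right ?_ (Real.log_nonneg (by norm_num))
  linarith

end Holevo

/-! ### States and operations -/

section Vectors

variable {α β : Type*}

/-- The projector `|ψ⟩⟨ψ|` onto the line spanned by a unit vector `ψ`. -/
def proj (ψ : α → ℂ) : Matrix α α ℂ := Matrix.vecMulVec ψ (star ψ)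

/-- The product vector `φ ⊗ ψ`. -/
def tensorVec (φ : α → ℂ) (ψ : β → ℂ) : α × β → ℂ := fun z => φ z.1 * ψ z.2

lemma proj_apply (ψ : α → ℂ) (i j : α) : proj ψ i j = ψ i * star (ψ j) := rfl

lemma proj_tensorVec (φ : α → ℂ) (ψ : β → ℂ) : proj (tensorVec φ ψ) = proj φ ⊗ₖ proj ψ := by
  ext ⟨i, j⟩ ⟨i', j'⟩
  simp only [proj_apply, tensorVec, Matrix.kroneckerMap_apply, star_mul']
  ring

lemma single_eq_proj [DecidableEq α] (a : α) :
    Matrix.single a a (1 : ℂ) = proj (Pi.single a 1) := by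
  ext i j
  simp only [proj_apply, Matrix.single_apply, Pi.single_apply, eq_comm (a := a)]
  split_ifs <;> simp_all

lemma sum_kronecker {ι : Type*} (s : Finset ι) (A : ι → Matrix α α ℂ) (B : Matrix β β ℂ) :
    (∑ i ∈ s, A i) ⊗ₖ B = ∑ i ∈ s, A i ⊗ₖ B := by
  ext ⟨i, j⟩ ⟨i', j'⟩
  simp [Matrix.sum_apply, Finset.sum_mul]

lemma kronecker_sub (A : Matrix α α ℂ) (B C : Matrix β β ℂ) :
    A ⊗ₖ (B - C) = A ⊗ₖ B - A ⊗ₖ C := by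
  ext ⟨i, j⟩ ⟨i', j'⟩
  simp [mul_sub]

lemma mul_proj_mul_conjTranspose [Fintype α] (V : Matrix β α ℂ) (ψ : α → ℂ) :
    V * proj ψ * Vᴴ = proj (V *ᵥ ψ) := by
  rw [proj, Matrix.mul_vecMulVec, Matrix.vecMulVec_mul, proj, Matrix.star_mulVec]

lemma star_tensorVec_dotProduct [Fintype α] [Fintype β] (φ φ' : α → ℂ) (ψ ψ' : β → ℂ) :
    star (tensorVec φ ψ) ⬝ᵥ tensorVec φ' ψ' = (star φ ⬝ᵥ φ') * (star ψ ⬝ᵥ ψ') := by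
  simp only [tensorVec, dotProduct, Fintype.sum_prod_type, Finset.sum_mul_sum, Pi.star_apply,
    star_mul']
  exact Finset.sum_congr rfl fun i _ => Finset.sum_congr rfl fun j _ => mul_mul_mul_comm _ _ _ _

lemma kronecker_mulVec_tensorVec [Fintype α] [Fintype β] (U : Matrix α α ℂ) (V : Matrix β β ℂ)
    (φ : α → ℂ) (ψ : β → ℂ) :
    (U ⊗ₖ V) *ᵥ tensorVec φ ψ = tensorVec (U *ᵥ φ) (V *ᵥ ψ) := by
  ext z
  simp only [Matrix.mulVec, dotProduct, Matrix.kroneckerMap_apply, Fintype.sum_prod_type,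
    tensorVec, Finset.sum_mul_sum, mul_mul_mul_comm]

lemma submatrix_mulVec_comp [Fintype α] [Fintype β] (e : α ≃ β) (U : Matrix β β ℂ) (v : β → ℂ) :
    U.submatrix e e *ᵥ (v ∘ e) = (U *ᵥ v) ∘ e := by
  rw [Matrix.submatrix_mulVec_equiv, Function.comp_assoc, e.self_comp_symm, Function.comp_id]

lemma star_comp_dotProduct_comp [Fintype α] [Fintype β] (e : α ≃ β) (u v : β → ℂ) :
    star (u ∘ e) ⬝ᵥ (v ∘ e) = star u ⬝ᵥ v :=
  e.sum_comp fun i => star (u i) * v i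

end Vectors

section States

variable {α β : Type}

lemma trFst_kronecker [Fintype α] (A : Matrix α α ℂ) (B : Matrix β β ℂ) :
    trFst (A ⊗ₖ B) = A.trace • B := by
  ext i j
  simp [trFst, Matrix.trace, Finset.sum_mul]

lemma trSnd_kronecker [Fintype β] (A : Matrix α α ℂ) (B : Matrix β β ℂ) :
    trSnd (A ⊗ₖ B) = B.trace • A := by
  ext i j
  simp [trSnd, Matrix.trace, Finset.mul_sum, mul_comm]

lemma trFst_eq_sum_submatrix [Fintype α] (ρ : Matrix (α × β) (α × β) ℂ) :
    trFst ρ = ∑ a, ρ.submatrix (Prod.mk a) (Prod.mk a) := by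
  ext i j
  simp [trFst, Matrix.sum_apply]

lemma trSnd_eq_sum_submatrix [Fintype β] (ρ : Matrix (α × β) (α × β) ℂ) :
    trSnd ρ = ∑ b, ρ.submatrix (fun a => (a, b)) fun a => (a, b) := by
  ext i j
  simp [trSnd, Matrix.sum_apply]

lemma trace_trFst [Fintype α] [Fintype β] (ρ : Matrix (α × β) (α × β) ℂ) :
    (trFst ρ).trace = ρ.trace :=
  (Fintype.sum_prod_type_right ρ.diag).symm

lemma trace_trSnd [Fintype α] [Fintype β] (ρ : Matrix (α × β) (α × β) ℂ) :
    (trSnd ρ).trace = ρ.trace :=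
  (Fintype.sum_prod_type ρ.diag).symm

lemma trSnd_sub [Fintype β] (ρ σ : Matrix (α × β) (α × β) ℂ) :
    trSnd (ρ - σ) = trSnd ρ - trSnd σ := by
  ext i j
  simp [trSnd]

lemma trSnd_smul [Fintype β] (c : ℂ) (ρ : Matrix (α × β) (α × β) ℂ) :
    trSnd (c • ρ) = c • trSnd ρ := by
  ext i j
  simp [trSnd, Finset.mul_sum]

lemma posSemidef_trFst [Fintype α] {ρ : Matrix (α × β) (α × β) ℂ} (hρ : ρ.PosSemidef) :
    (trFst ρ).PosSemidef := by
  rw [trFst_eq_sum_submatrix]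
  exact Matrix.posSemidef_sum _ fun a _ => hρ.submatrix _

lemma posSemidef_trSnd [Fintype β] {ρ : Matrix (α × β) (α × β) ℂ} (hρ : ρ.PosSemidef) :
    (trSnd ρ).PosSemidef := by
  rw [trSnd_eq_sum_submatrix]
  exact Matrix.posSemidef_sum _ fun b _ => hρ.submatrix _

/-- A density matrix, the state of a register. -/
structure IsDensity [Fintype α] (ρ : Matrix α α ℂ) : Prop where
  posSemidef : ρ.PosSemidef
  trace_eq_one : ρ.trace = 1

lemma isDensity_proj [Fintype α] {ψ : α → ℂ} (hψ : star ψ ⬝ᵥ ψ = 1) : IsDensity (proj ψ) where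
  posSemidef := Matrix.posSemidef_vecMulVec_self_star ψ
  trace_eq_one := by rw [proj, Matrix.trace_vecMulVec, dotProduct_comm, hψ]

lemma isDensity_single [Fintype α] [DecidableEq α] (a : α) :
    IsDensity (Matrix.single a a (1 : ℂ)) := by
  rw [single_eq_proj]
  exact isDensity_proj (by simp)

namespace IsDensity

variable [Fintype α] [Fintype β] {ρ : Matrix α α ℂ} {σ : Matrix β β ℂ}
  {τ : Matrix (α × β) (α × β) ℂ}

protected lemma kronecker (hρ : IsDensity ρ) (hσ : IsDensity σ) : IsDensity (ρ ⊗ₖ σ) where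
  posSemidef := by
    classical
    exact hρ.posSemidef.kronecker hσ.posSemidef
  trace_eq_one := by rw [Matrix.trace_kronecker, hρ.trace_eq_one, hσ.trace_eq_one, mul_one]

protected lemma trFst (hτ : IsDensity τ) : IsDensity (trFst τ) :=
  ⟨posSemidef_trFst hτ.posSemidef, (trace_trFst τ).trans hτ.trace_eq_one⟩

protected lemma trSnd (hτ : IsDensity τ) : IsDensity (trSnd τ) :=
  ⟨posSemidef_trSnd hτ.posSemidef, (trace_trSnd τ).trans hτ.trace_eq_one⟩

lemma posSemidef_one_sub [DecidableEq α] (hρ : IsDensity ρ) : (1 - ρ).PosSemidef := by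
  have hH := hρ.posSemidef.isHermitian
  have hle (i) : hH.eigenvalues i ≤ 1 := by
    rw [← sum_eigenvalues_eq hH (q := 1) (by simpa using hρ.trace_eq_one)]
    exact Finset.single_le_sum (fun j _ => hρ.posSemidef.eigenvalues_nonneg j) (Finset.mem_univ i)
  have hdiag :
      (1 - Matrix.diagonal (RCLike.ofReal ∘ hH.eigenvalues) : Matrix α α ℂ).PosSemidef := by
    rw [← Matrix.diagonal_one, Matrix.diagonal_sub]
    exact Matrix.PosSemidef.diagonal fun i => by
      simpa using sub_nonneg.2 (Complex.real_le_real.2 (hle i))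
  rw [hH.spectral_theorem, ← map_one (Unitary.conjStarAlgAut ℂ _ hH.eigenvectorUnitary),
    ← map_sub, Unitary.conjStarAlgAut_apply]
  exact hdiag.mul_mul_conjTranspose_same _

end IsDensity

end States

section Isometries

variable {α β : Type*}

/-- `V` preserves inner products. -/
def IsIsometry [Fintype β] [DecidableEq α] (V : Matrix β α ℂ) : Prop := Vᴴ * V = 1

lemma isIsometry_one [Fintype α] [DecidableEq α] : IsIsometry (1 : Matrix α α ℂ) := by
  rw [IsIsometry, Matrix.conjTranspose_one, Matrix.one_mul]

namespace IsIsometry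

variable [Fintype β] [DecidableEq α] {V : Matrix β α ℂ}

lemma star_mulVec_dotProduct_mulVec [Fintype α] (hV : IsIsometry V) (ψ φ : α → ℂ) :
    star (V *ᵥ ψ) ⬝ᵥ (V *ᵥ φ) = star ψ ⬝ᵥ φ := by
  rw [Matrix.star_mulVec, ← Matrix.dotProduct_mulVec, Matrix.mulVec_mulVec, hV,
    Matrix.one_mulVec]

lemma kronecker {γ δ : Type*} [Fintype δ] [DecidableEq γ] {W : Matrix δ γ ℂ}
    (hV : IsIsometry V) (hW : IsIsometry W) : IsIsometry (V ⊗ₖ W) := by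
  rw [IsIsometry, Matrix.conjTranspose_kronecker, ← Matrix.mul_kronecker_mul, hV, hW,
    Matrix.one_kronecker_one]

lemma submatrix {γ δ : Type*} [Fintype γ] [DecidableEq δ] (hV : IsIsometry V) (e : γ ≃ β)
    (e' : δ ≃ α) : IsIsometry (V.submatrix e e') := by
  rw [IsIsometry, Matrix.conjTranspose_submatrix, Matrix.submatrix_mul_equiv, hV,
    Matrix.submatrix_one_equiv]

end IsIsometry

end Isometries

namespace Channel

variable {α β γ : Type} [Fintype α] [DecidableEq α] [Fintype β] [Fintype γ] [DecidableEq γ]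

/-- Apply an operation to a state. -/
def app (T : Channel α β) (ρ : Matrix α α ℂ) : Matrix β β ℂ :=
  ∑ i, T.kraus i * ρ * (T.kraus i)ᴴ

lemma act_kronecker (T : Channel α β) (ρ : Matrix α α ℂ) (σ : Matrix γ γ ℂ) :
    T.act (ρ ⊗ₖ σ) = T.app ρ ⊗ₖ σ := by
  simp only [act, app, sum_kronecker, Matrix.conjTranspose_kronecker, ← Matrix.mul_kronecker_mul,
    Matrix.conjTranspose_one, Matrix.one_mul, Matrix.mul_one]

lemma app_sub (T : Channel α β) (ρ σ : Matrix α α ℂ) : T.app (ρ - σ) = T.app ρ - T.app σ := by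
  simp [app, Matrix.mul_sub, Matrix.sub_mul]

lemma app_smul (T : Channel α β) (c : ℂ) (ρ : Matrix α α ℂ) : T.app (c • ρ) = c • T.app ρ := by
  simp [app, Finset.smul_sum]

lemma app_sum {ι : Type*} (s : Finset ι) (T : Channel α β) (ρ : ι → Matrix α α ℂ) :
    T.app (∑ a ∈ s, ρ a) = ∑ a ∈ s, T.app (ρ a) := by
  simp only [app, Matrix.mul_sum, Matrix.sum_mul]
  rw [Finset.sum_comm]

lemma posSemidef_app (T : Channel α β) {ρ : Matrix α α ℂ} (hρ : ρ.PosSemidef) :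
    (T.app ρ).PosSemidef :=
  Matrix.posSemidef_sum _ fun _ _ => hρ.mul_mul_conjTranspose_same _

lemma trace_app (T : Channel α β) (ρ : Matrix α α ℂ) : (T.app ρ).trace = ρ.trace := by
  rw [app, Matrix.trace_sum,
    Finset.sum_congr rfl fun i _ => Matrix.trace_mul_cycle (T.kraus i) ρ (T.kraus i)ᴴ,
    ← Matrix.trace_sum, ← Matrix.sum_mul, T.complete, Matrix.one_mul]

lemma isDensity_app (T : Channel α β) {ρ : Matrix α α ℂ} (hρ : IsDensity ρ) :
    IsDensity (T.app ρ) :=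
  ⟨T.posSemidef_app hρ.posSemidef, (T.trace_app ρ).trans hρ.trace_eq_one⟩

lemma app_proj (T : Channel α β) (ψ : α → ℂ) :
    T.app (proj ψ) = ∑ i, proj (T.kraus i *ᵥ ψ) := by
  simp only [app, mul_proj_mul_conjTranspose]

lemma sum_star_mulVec_dotProduct_mulVec (T : Channel α β) (ψ φ : α → ℂ) :
    ∑ i, star (T.kraus i *ᵥ ψ) ⬝ᵥ (T.kraus i *ᵥ φ) = star ψ ⬝ᵥ φ := by
  simp only [Matrix.star_mulVec, ← Matrix.dotProduct_mulVec, Matrix.mulVec_mulVec]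
  rw [← dotProduct_sum, ← Matrix.sum_mulVec, T.complete, Matrix.one_mulVec]

/-- The operation `ρ ↦ V ρ Vᴴ` of an isometry `V`. -/
def ofIsometry (V : Matrix β α ℂ) (hV : IsIsometry V) : Channel α β where
  num := 1
  kraus := fun _ => V
  complete := (Fin.sum_univ_one _).trans hV

lemma ofIsometry_app_proj (V : Matrix β α ℂ) (hV : IsIsometry V) (ψ : α → ℂ) :
    (ofIsometry V hV).app (proj ψ) = proj (V *ᵥ ψ) :=
  (app_proj _ ψ).trans (Fin.sum_univ_one _)

lemma ofIsometry_one_kronecker_app [DecidableEq β] {V : Matrix β β ℂ} (hV : IsIsometry V)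
    (ρ : Matrix γ γ ℂ) (ψ : β → ℂ) :
    (ofIsometry ((1 : Matrix γ γ ℂ) ⊗ₖ V) (isIsometry_one.kronecker hV)).app (ρ ⊗ₖ proj ψ) =
      ρ ⊗ₖ proj (V *ᵥ ψ) := by
  refine (Fin.sum_univ_one _).trans ?_
  change ((1 : Matrix γ γ ℂ) ⊗ₖ V) * (ρ ⊗ₖ proj ψ) * ((1 : Matrix γ γ ℂ) ⊗ₖ V)ᴴ = _
  rw [Matrix.conjTranspose_kronecker, ← Matrix.mul_kronecker_mul,
    ← Matrix.mul_kronecker_mul, mul_proj_mul_conjTranspose, Matrix.conjTranspose_one,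
    Matrix.one_mul, Matrix.mul_one]

end Channel

/-! ### The divulged information -/

section Divulged

lemma trMid_blockDiagonal {α β γ : Type} [Fintype β] [DecidableEq β] [DecidableEq γ]
    (M : β × γ → Matrix α α ℂ) :
    trMid (Matrix.blockDiagonal M) = Matrix.blockDiagonal fun c => ∑ b, M (b, c) := by
  ext ⟨a, c⟩ ⟨a', c'⟩
  simp only [trMid, Matrix.of_apply, Matrix.blockDiagonal_apply, Prod.mk.injEq, true_and]
  split_ifs <;> simp [Matrix.sum_apply]

lemma trFst_blockDiagonal {α β : Type} [Fintype α] [DecidableEq β] (M : β → Matrix α α ℂ) :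
    trFst (Matrix.blockDiagonal M) = Matrix.diagonal fun b => (M b).trace := by
  ext b b'
  simp only [trFst, Matrix.of_apply, Matrix.blockDiagonal_apply, Matrix.diagonal_apply]
  split_ifs <;> simp [Matrix.trace]

lemma trFst_diagonal {α β : Type} [Fintype α] [DecidableEq α] [DecidableEq β] (d : α × β → ℂ) :
    trFst (Matrix.diagonal d) = Matrix.diagonal fun b => ∑ a, d (a, b) := by
  ext b b'
  simp only [trFst, Matrix.of_apply, Matrix.diagonal_apply, Prod.mk.injEq, true_and]
  split_ifs <;> simp

variable {X Y Z R : Type} [DecidableEq Z]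

/-- The joint distribution of `X` and the pair `(Y, f X Y)`. -/
def jointDist (f : X → Y → Z) (μ : X × Y → ℝ) (x : X) (w : Y × Z) : ℝ :=
  if f x w.1 = w.2 then μ (x, w.1) else 0

lemma jointDist_nonneg (f : X → Y → Z) {μ : X × Y → ℝ} (hμ : ∀ p, 0 ≤ μ p) (x : X) (w : Y × Z) :
    0 ≤ jointDist f μ x w := by
  unfold jointDist
  split_ifs
  exacts [hμ _, le_rfl]

variable [Fintype X] [Fintype Y]

lemma sum_jointDist [Fintype Z] (f : X → Y → Z) (μ : X × Y → ℝ) :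
    ∑ w, ∑ x, jointDist f μ x w = ∑ p, μ p := by
  rw [Finset.sum_comm, Fintype.sum_prod_type]
  refine Finset.sum_congr rfl fun x _ => ?_
  simp [jointDist, Fintype.sum_prod_type]

variable [DecidableEq X] [DecidableEq Y]

lemma cqState_eq_blockDiagonal (f : X → Y → Z) (μ : X × Y → ℝ) (σ : X → Y → Matrix R R ℂ) :
    cqState f μ σ = Matrix.blockDiagonal fun w : X × (Y × Z) =>
      (jointDist f μ w.1 w.2 : ℂ) • σ w.1 w.2.1 := by
  ext ⟨r, x, y, z⟩ ⟨r', x', y', z'⟩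
  simp only [cqState, jointDist, Matrix.sum_apply, Matrix.smul_apply, Matrix.kroneckerMap_apply,
    Matrix.blockDiagonal_apply, Matrix.single_apply, smul_eq_mul, Prod.mk.injEq]
  rw [Finset.sum_eq_single x (fun b _ hb => by simp [hb]) (by simp),
    Finset.sum_eq_single y (fun b _ hb => by simp [hb]) (by simp)]
  by_cases hx : x = x' <;> by_cases hy : y = y' <;> by_cases hz : z = z' <;>
    by_cases hf : f x y = z <;> simp_all

variable [Fintype Z] [Fintype R] [DecidableEq R]

lemma divulged_eq (f : X → Y → Z) (μ : X × Y → ℝ) {σ : X → Y → Matrix R R ℂ}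
    (hσ : ∀ x y, (σ x y).trace = 1) :
    divulged f μ σ = ∑ w : Y × Z,
      (entropy (∑ x, (jointDist f μ x w : ℂ) • σ x w.1) +
        (∑ x, Real.negMulLog (jointDist f μ x w)) / Real.log 2 -
        Real.negMulLog (∑ x, jointDist f μ x w) / Real.log 2 -
        ∑ x, entropy ((jointDist f μ x w : ℂ) • σ x w.1)) := by
  have hX : trFst (cqState f μ σ) =
      Matrix.diagonal fun w : X × (Y × Z) => (jointDist f μ w.1 w.2 : ℂ) := by
    simp only [cqState_eq_blockDiagonal, trFst_blockDiagonal, Matrix.trace_smul, hσ, smul_eq_mul,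
      mul_one]
  have hY : trFst (trFst (cqState f μ σ)) =
      Matrix.diagonal fun w : Y × Z => ((∑ x, jointDist f μ x w : ℝ) : ℂ) := by
    rw [hX, trFst_diagonal]
    simp only [Complex.ofReal_sum]
  rw [divulged, condMutualInfo, hY, hX, cqState_eq_blockDiagonal, trMid_blockDiagonal,
    entropy_blockDiagonal, entropy_blockDiagonal, entropy_diagonal, entropy_diagonal,
    Fintype.sum_prod_type_right
      (fun w : X × (Y × Z) => Real.negMulLog (jointDist f μ w.1 w.2)),
    Fintype.sum_prod_type_right
      (fun w : X × (Y × Z) => entropy ((jointDist f μ w.1 w.2 : ℂ) • σ w.1 w.2.1))]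
  simp only [Finset.sum_sub_distrib, Finset.sum_add_distrib, ← Finset.sum_div]

lemma divulged_le_of_dominated (f : X → Y → Z) {μ : X × Y → ℝ} (hμ : μ ∈ stdSimplex ℝ (X × Y))
    {σ : X → Y → Matrix R R ℂ} {τ : Y → Matrix R R ℂ} {D : ℝ} (hD : 0 < D)
    (hσ : ∀ x y, IsDensity (σ x y)) (hτ : ∀ y, IsDensity (τ y))
    (h : ∀ x y, ((D : ℂ) • τ y - σ x y).PosSemidef) :
    divulged f μ σ ≤ Real.logb 2 D := by
  have hp (x w) : (0 : ℂ) ≤ jointDist f μ x w :=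
    Complex.zero_le_real.2 (jointDist_nonneg f hμ.1 x w)
  have hholevo (w : Y × Z) := holevo_bound_of_dominated hD
    (W := fun x => (jointDist f μ x w : ℂ) • σ x w.1) (p := fun x => jointDist f μ x w)
    (fun x => (hσ x w.1).posSemidef.smul (hp x w)) (hτ w.1).posSemidef (hτ w.1).trace_eq_one
    (fun x => by rw [Matrix.trace_smul, (hσ x w.1).trace_eq_one, smul_eq_mul, mul_one])
    (fun x => by
      rw [Complex.ofReal_mul, mul_smul, ← smul_sub]
      exact (h x w.1).smul (hp x w))
  calc divulged f μ σ
      ≤ ∑ w : Y × Z, (∑ x, jointDist f μ x w) * Real.logb 2 D := by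
        rw [divulged_eq f μ fun x y => (hσ x y).trace_eq_one]
        exact Finset.sum_le_sum fun w _ => by linarith [hholevo w]
    _ = Real.logb 2 D := by rw [← Finset.sum_mul, sum_jointDist, hμ.2, one_mul]

lemma divulged_const_nonpos (f : X → Y → Z) {μ : X × Y → ℝ} (hμ : μ ∈ stdSimplex ℝ (X × Y))
    {τ : Y → Matrix R R ℂ} (hτ : ∀ y, IsDensity (τ y)) : divulged f μ (fun _ y => τ y) ≤ 0 := by
  have hle := divulged_le_of_dominated f hμ one_pos (fun _ => hτ) hτ
    (fun _ y => by simpa using Matrix.PosSemidef.zero)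
  rwa [Real.logb_one] at hle

/-- The maximally mixed state. -/
def mixed (M : Type) [Fintype M] [DecidableEq M] : Matrix M M ℂ := (Fintype.card M : ℂ)⁻¹ • 1

variable {P M : Type} [Fintype P] [Fintype M] [DecidableEq M] [Nonempty M]

lemma isDensity_mixed : IsDensity (mixed M) :=
  ⟨Matrix.PosSemidef.one.smul (by positivity), by simp [mixed]⟩

lemma card_smul_mixed : (Fintype.card M : ℂ) • mixed M = 1 := by
  simp [mixed, smul_smul]

lemma posSemidef_card_smul_kronecker_mixed_sub {σ : Matrix P P ℂ} {ρ : Matrix M M ℂ}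
    (hσ : IsDensity σ) (hρ : IsDensity ρ) :
    ((Fintype.card M : ℂ) • (σ ⊗ₖ mixed M) - σ ⊗ₖ ρ).PosSemidef := by
  classical
  rw [← Matrix.kronecker_smul, card_smul_mixed, ← kronecker_sub]
  exact hσ.posSemidef.kronecker hρ.posSemidef_one_sub

lemma divulged_kronecker_le [DecidableEq P] (f : X → Y → Z) {μ : X × Y → ℝ}
    (hμ : μ ∈ stdSimplex ℝ (X × Y)) {σ : Y → Matrix P P ℂ} {ρ : X → Y → Matrix M M ℂ}
    (hσ : ∀ y, IsDensity (σ y)) (hρ : ∀ x y, IsDensity (ρ x y)) :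
    divulged f μ (fun x y => σ y ⊗ₖ ρ x y) ≤ Real.logb 2 (Fintype.card M) :=
  divulged_le_of_dominated f hμ (τ := fun y => σ y ⊗ₖ mixed M)
    (Nat.cast_pos.2 Fintype.card_pos) (fun x y => (hσ y).kronecker (hρ x y))
    (fun y => (hσ y).kronecker isDensity_mixed)
    (fun x y => mod_cast posSemidef_card_smul_kronecker_mixed_sub (hσ y) (hρ x y))

lemma divulged_trSnd_app_le [DecidableEq P] {N : Type} [Fintype N] (f : X → Y → Z)
    {μ : X × Y → ℝ} (hμ : μ ∈ stdSimplex ℝ (X × Y)) (T : Y → Channel (P × M) (R × N))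
    {σ : Y → Matrix P P ℂ} {ρ : X → Y → Matrix M M ℂ} (hσ : ∀ y, IsDensity (σ y))
    (hρ : ∀ x y, IsDensity (ρ x y)) :
    divulged f μ (fun x y => trSnd ((T y).app (σ y ⊗ₖ ρ x y))) ≤
      Real.logb 2 (Fintype.card M) := by
  refine divulged_le_of_dominated f hμ (τ := fun y => trSnd ((T y).app (σ y ⊗ₖ mixed M)))
    (Nat.cast_pos.2 Fintype.card_pos)
    (fun x y => ((T y).isDensity_app ((hσ y).kronecker (hρ x y))).trSnd)
    (fun y => ((T y).isDensity_app ((hσ y).kronecker isDensity_mixed)).trSnd) fun x y => ?_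
  rw [← trSnd_smul, ← Channel.app_smul, ← trSnd_sub, ← Channel.app_sub]
  exact posSemidef_trSnd ((T y).posSemidef_app
    (mod_cast posSemidef_card_smul_kronecker_mixed_sub (hσ y) (hρ x y)))

end Divulged

/-! ### Information gain against disturbance -/

section Disturbance

variable {α β α' β' : Type} {κ ι : Type*} [Fintype α] [Fintype β] [Fintype κ]

lemma eq_smul_of_sum_proj_eq_proj {r : κ → α → ℂ} {φ : α → ℂ} (hφ : star φ ⬝ᵥ φ = 1)
    (h : ∑ k, proj (r k) = proj φ) (k : κ) : r k = (star φ ⬝ᵥ r k) • φ := by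
  set v : α → ℂ := r k - (star φ ⬝ᵥ r k) • φ with hv
  have quad (ψ : α → ℂ) : star v ⬝ᵥ (proj ψ *ᵥ v) = star (star ψ ⬝ᵥ v) * (star ψ ⬝ᵥ v) := by
    rw [proj, Matrix.vecMulVec_mulVec, op_smul_eq_smul, dotProduct_smul, smul_eq_mul, mul_comm,
      ← Matrix.star_dotProduct_star, star_star]
  have hφv : star φ ⬝ᵥ v = 0 := by
    rw [hv, dotProduct_sub, dotProduct_smul, hφ, smul_eq_mul, mul_one, sub_self]
  have hsum : ∑ k, star (star (r k) ⬝ᵥ v) * (star (r k) ⬝ᵥ v) = 0 := by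
    simp only [← quad]
    rw [← dotProduct_sum, ← Matrix.sum_mulVec, h, quad, hφv, mul_zero]
  have hrv : star (r k) ⬝ᵥ v = 0 :=
    (CStarRing.star_mul_self_eq_zero_iff _).1 <|
      (Finset.sum_eq_zero_iff_of_nonneg fun _ _ => star_mul_self_nonneg _).1 hsum k
        (Finset.mem_univ k)
  have hvv : star v ⬝ᵥ v = 0 := by
    nth_rewrite 1 [hv]
    rw [star_sub, sub_dotProduct, hrv, star_smul, smul_dotProduct, hφv, smul_zero, sub_zero]
  exact sub_eq_zero.1 (dotProduct_star_self_eq_zero.1 hvv)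

lemma eq_tensorVec_of_trFst_sum_proj_eq_proj {w : κ → α × β → ℂ} {φ : β → ℂ}
    (hφ : star φ ⬝ᵥ φ = 1) (h : trFst (∑ k, proj (w k)) = proj φ) (k : κ) :
    w k = tensorVec (fun a => star φ ⬝ᵥ fun b => w k (a, b)) φ := by
  have hrows : ∑ p : κ × α, proj (fun b => w p.1 (p.2, b)) = proj φ := by
    rw [← h, Fintype.sum_prod_type, Finset.sum_comm, trFst_eq_sum_submatrix]
    ext b b'
    simp [Matrix.sum_apply, proj_apply]
  ext ⟨a, b⟩
  exact congrFun (eq_smul_of_sum_proj_eq_proj hφ hrows (k, a)) b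

lemma eq_of_sum_star_dotProduct_eq {u : ι → κ → α → ℂ} {c : ℂ}
    (h : ∀ x x', ∑ k, star (u x k) ⬝ᵥ u x' k = c) (x x' : ι) : u x = u x' := by
  have hdiff : ∑ k, star (u x k - u x' k) ⬝ᵥ (u x k - u x' k) = 0 := by
    simp only [star_sub, sub_dotProduct, dotProduct_sub, Finset.sum_sub_distrib, h, sub_self]
  ext1 k
  exact sub_eq_zero.1 <| dotProduct_star_self_eq_zero.1 <|
    (Finset.sum_eq_zero_iff_of_nonneg fun _ _ => dotProduct_star_self_nonneg _).1 hdiff k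
      (Finset.mem_univ k)

variable [DecidableEq α] [DecidableEq β] [Fintype α'] [Fintype β']

lemma Channel.app_kronecker_proj_eq_sum (T : Channel (α × β) (α' × β')) (v : κ → α → ℂ)
    (ψ : β → ℂ) :
    T.app ((∑ a, proj (v a)) ⊗ₖ proj ψ) =
      ∑ p : κ × Fin T.num, proj (T.kraus p.2 *ᵥ tensorVec (v p.1) ψ) := by
  simp only [sum_kronecker, ← proj_tensorVec, app_sum, app_proj, Fintype.sum_prod_type]

/-- Dividing the inner products of the final states of the whole system by those of the `φ x` shows
that the residual states on `α'` have inner products independent of `x`, so that they coincide. -/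
theorem Channel.exists_app_eq_kronecker_proj [Nonempty ι] (T : Channel (α × β) (α' × β'))
    {σ : Matrix α α ℂ} (hσ : IsDensity σ) {ψ : ι → β → ℂ} {φ : ι → β' → ℂ}
    (hψ : ∀ x, star (ψ x) ⬝ᵥ ψ x = 1) (hne : ∀ x x', star (ψ x) ⬝ᵥ ψ x' ≠ 0)
    (hgram : ∀ x x', star (φ x) ⬝ᵥ φ x' = star (ψ x) ⬝ᵥ ψ x')
    (hpure : ∀ x, trFst (T.app (σ ⊗ₖ proj (ψ x))) = proj (φ x)) :
    ∃ σ' : Matrix α' α' ℂ, IsDensity σ' ∧ ∀ x, T.app (σ ⊗ₖ proj (ψ x)) = σ' ⊗ₖ proj (φ x) := by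
  obtain ⟨n, v, rfl⟩ : ∃ (n : ℕ) (v : Fin n → α → ℂ), σ = ∑ a, proj (v a) :=
    Matrix.posSemidef_iff_eq_sum_vecMulVec.1 hσ.posSemidef
  have hφ (x) : star (φ x) ⬝ᵥ φ x = 1 := (hgram x x).trans (hψ x)
  set w : ι → Fin n × Fin T.num → α' × β' → ℂ :=
    fun x p => T.kraus p.2 *ᵥ tensorVec (v p.1) (ψ x)
  have happ (x) : T.app ((∑ a, proj (v a)) ⊗ₖ proj (ψ x)) = ∑ p, proj (w x p) :=
    T.app_kronecker_proj_eq_sum v (ψ x)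
  obtain ⟨u, hwu⟩ : ∃ u : ι → Fin n × Fin T.num → α' → ℂ,
      ∀ x p, w x p = tensorVec (u x p) (φ x) :=
    ⟨_, fun x => eq_tensorVec_of_trFst_sum_proj_eq_proj (hφ x) (happ x ▸ hpure x)⟩
  have hinner (x x') : ∑ p, star (u x p) ⬝ᵥ u x' p = ∑ a, star (v a) ⬝ᵥ v a := by
    refine mul_right_cancel₀ (hne x x') ?_
    calc (∑ p, star (u x p) ⬝ᵥ u x' p) * (star (ψ x) ⬝ᵥ ψ x')
        = ∑ p, star (w x p) ⬝ᵥ w x' p := by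
          simp only [Finset.sum_mul, hwu, star_tensorVec_dotProduct, hgram]
      _ = (∑ a, star (v a) ⬝ᵥ v a) * (star (ψ x) ⬝ᵥ ψ x') := by
          simp only [w, Fintype.sum_prod_type, T.sum_star_mulVec_dotProduct_mulVec,
            star_tensorVec_dotProduct, Finset.sum_mul]
  have hout (x x') : T.app ((∑ a, proj (v a)) ⊗ₖ proj (ψ x)) =
      (∑ p, proj (u x' p)) ⊗ₖ proj (φ x) := by
    rw [happ, sum_kronecker]
    simp only [hwu, proj_tensorVec, eq_of_sum_star_dotProduct_eq hinner x x']
  obtain ⟨x₀⟩ := ‹Nonempty ι›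
  refine ⟨∑ p, proj (u x₀ p), ⟨Matrix.posSemidef_sum _ fun p _ =>
    Matrix.posSemidef_vecMulVec_self_star _, ?_⟩, fun x => hout x x₀⟩
  have htrace := (T.isDensity_app (hσ.kronecker (isDensity_proj (hψ x₀)))).trace_eq_one
  rwa [hout x₀ x₀, Matrix.trace_kronecker, (isDensity_proj (hφ x₀)).trace_eq_one, mul_one]
    at htrace

end Disturbance

/-! ### Runs in which the two players are not entangled -/

section Pass

variable {P M O P' M' : Type}

lemma pass_kronecker (a : Matrix P P ℂ) (b : Matrix M M ℂ) (c : Matrix O O ℂ) :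
    pass ((a ⊗ₖ b) ⊗ₖ c) = (c ⊗ₖ b) ⊗ₖ a := by
  ext ⟨⟨i, j⟩, k⟩ ⟨⟨i', j'⟩, k'⟩
  simp only [pass, Matrix.submatrix_apply, Matrix.kroneckerMap_apply]
  ring

lemma trFst_pass [Fintype M] [Fintype O] (ρ : Matrix ((P × M) × O) ((P × M) × O) ℂ) :
    trFst (pass ρ) = trSnd (trSnd ρ) := by
  ext i j
  simp only [trFst, trSnd, pass, Matrix.of_apply, Matrix.submatrix_apply, Fintype.sum_prod_type]
  rw [Finset.sum_comm]

lemma trSnd_pass_kronecker [Fintype P] (ρ : Matrix (P × M) (P × M) ℂ) (c : Matrix O O ℂ) :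
    trSnd (pass (ρ ⊗ₖ c)) = c ⊗ₖ trFst ρ := by
  ext ⟨o, m⟩ ⟨o', m'⟩
  simp [trSnd, pass, trFst, Finset.mul_sum, mul_comm]

lemma IsDensity.trFst_kronecker [Fintype P] {a : Matrix P P ℂ} (ha : IsDensity a)
    (b : Matrix M M ℂ) : QPrivacy.trFst (a ⊗ₖ b) = b := by
  rw [QPrivacy.trFst_kronecker, ha.trace_eq_one, one_smul]

lemma IsDensity.trSnd_kronecker [Fintype M] {b : Matrix M M ℂ} (hb : IsDensity b)
    (a : Matrix P P ℂ) : QPrivacy.trSnd (a ⊗ₖ b) = a := by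
  rw [QPrivacy.trSnd_kronecker, hb.trace_eq_one, one_smul]

variable [Fintype P] [DecidableEq P] [Fintype M] [DecidableEq M] [Fintype O] [DecidableEq O]
  [Fintype P'] [Fintype M'] {T : Channel (P × M) (P' × M')}
  {ρ : Matrix ((P × M) × O) ((P × M) × O) ℂ} {r : Matrix (P × M) (P × M) ℂ} {c : Matrix O O ℂ}

lemma pass_act_of_app_eq {a : Matrix P P ℂ} {b : Matrix M M ℂ} {a' : Matrix P' P' ℂ}
    {b' : Matrix M' M' ℂ} (hρ : ρ = (a ⊗ₖ b) ⊗ₖ c) (hT : T.app (a ⊗ₖ b) = a' ⊗ₖ b') :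
    pass (T.act ρ) = (c ⊗ₖ b') ⊗ₖ a' := by
  rw [hρ, Channel.act_kronecker, hT, pass_kronecker]

lemma trSnd_pass_act (hρ : ρ = r ⊗ₖ c) : trSnd (pass (T.act ρ)) = c ⊗ₖ trFst (T.app r) := by
  rw [hρ, Channel.act_kronecker, trSnd_pass_kronecker]

lemma trFst_pass_act (hρ : ρ = r ⊗ₖ c) (hc : IsDensity c) :
    trFst (pass (T.act ρ)) = trSnd (T.app r) := by
  rw [hρ, Channel.act_kronecker, trFst_pass, hc.trSnd_kronecker]

lemma trFst_trSnd_pass_act (hρ : ρ = r ⊗ₖ c) (hc : IsDensity c) :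
    trFst (trSnd (pass (T.act ρ))) = trFst (T.app r) := by
  rw [trSnd_pass_act hρ, hc.trFst_kronecker]

end Pass

/-- The state of a register of `k` qubits before anything has been done with it. -/
def blank (k : ℕ) : Matrix (Reg k) (Reg k) ℂ := Matrix.single 0 0 1

lemma isDensity_blank (k : ℕ) : IsDensity (blank k) := isDensity_single 0

lemma blank_eq_proj (k : ℕ) : blank k = proj (Pi.single 0 1) := single_eq_proj 0

lemma run_zero {X Y : Type} {qA qB : ℕ → ℕ} (A : Strategy X qB qA)
    (B : Strategy Y qA fun k => qB (k + 1)) (x : X) (y : Y) :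
    run A B x y 0 = (blank _ ⊗ₖ blank _) ⊗ₖ blank _ := by
  rw [run, blank, blank, blank, Matrix.single_kronecker_single, Matrix.single_kronecker_single,
    mul_one, mul_one]
  rfl

/-! ### Protocols that send a pure register to and fro -/

/-- Data for a protocol in which a register of `q` qubits is sent to and fro, so that all messages
but the last one are pure states. Al holds no private qubits; Bob holds one, into which he writes
the result in his last turn. He applies `opBob` in the `turns` turns before it. -/
structure PingPong (X Y Z : Type) (q : ℕ) where
  turns : ℕ
  init : X → Reg q → ℂ
  init_unit : ∀ x, star (init x) ⬝ᵥ init x = 1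
  opAl : ℕ → X → Matrix (Reg q) (Reg q) ℂ
  opAl_isIsometry : ∀ k x, IsIsometry (opAl k x)
  opBob : Y → Matrix (Reg q) (Reg q) ℂ
  opBob_isIsometry : ∀ y, IsIsometry (opBob y)
  final : Y → Equiv.Perm (Reg 1 × Reg q)
  outAl : Reg q → Z
  outBob : Reg 1 → Z

namespace PingPong

variable {X Y Z : Type} {q : ℕ} (S : PingPong X Y Z q)

/-- The state of the register when Al sends it in his turn `k`. -/
def msg (x : X) (y : Y) : ℕ → Reg q → ℂ
  | 0 => S.init x
  | k + 1 => S.opAl k x *ᵥ (S.opBob y *ᵥ msg x y k)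

/-- The state of the register when Bob returns it in his turn `k`, unless that is his last one. -/
def reply (x : X) (y : Y) (k : ℕ) : Reg q → ℂ := S.opBob y *ᵥ S.msg x y k

lemma star_reply_dotProduct_reply (x x' : X) (y : Y) (k : ℕ) :
    star (S.reply x y k) ⬝ᵥ S.reply x' y k = star (S.msg x y k) ⬝ᵥ S.msg x' y k :=
  (S.opBob_isIsometry y).star_mulVec_dotProduct_mulVec _ _

lemma star_msg_succ_dotProduct_msg_succ (x : X) (y y' : Y) (k : ℕ) :
    star (S.msg x y (k + 1)) ⬝ᵥ S.msg x y' (k + 1) = star (S.reply x y k) ⬝ᵥ S.reply x y' k :=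
  (S.opAl_isIsometry k x).star_mulVec_dotProduct_mulVec _ _

lemma msg_unit (x : X) (y : Y) (k : ℕ) : star (S.msg x y k) ⬝ᵥ S.msg x y k = 1 := by
  induction k with
  | zero => exact S.init_unit x
  | succ k ih => rw [star_msg_succ_dotProduct_msg_succ, star_reply_dotProduct_reply, ih]

lemma isDensity_msg (x : X) (y : Y) (k : ℕ) : IsDensity (proj (S.msg x y k)) :=
  isDensity_proj (S.msg_unit x y k)

/-- The sizes of the messages of Bob. -/
def replySize (q : ℕ) : ℕ → ℕ
  | 0 => 0
  | _ + 1 => q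

/-- The matrix of the operation by which Al prepares his first message. -/
def initMatrix (x : X) : Matrix (Reg 0 × Reg q) (Reg 0 × Reg 0) ℂ :=
  Matrix.of fun i _ => S.init x i.2

lemma isIsometry_initMatrix (x : X) : IsIsometry (S.initMatrix x) := by
  ext i j
  rw [Subsingleton.elim i j, Matrix.one_apply_eq, ← S.init_unit x, Matrix.mul_apply,
    Fintype.sum_prod_type, Fintype.sum_unique]
  rfl

/-- The operation by which Al prepares his first message. -/
def initOp (x : X) : Channel (Reg 0 × Reg 0) (Reg 0 × Reg q) :=
  Channel.ofIsometry (S.initMatrix x) (S.isIsometry_initMatrix x)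

/-- The operations of Al. -/
def alOp : (k : ℕ) → X → Channel (Reg 0 × Reg (replySize q k)) (Reg 0 × Reg q)
  | 0, x => S.initOp x
  | k + 1, x =>
    Channel.ofIsometry (1 ⊗ₖ S.opAl k x) (isIsometry_one.kronecker (S.opAl_isIsometry k x))

/-- The matrix of Bob's last operation. -/
def finalMatrix (y : Y) : Matrix (Reg 1 × Reg q) (Reg 1 × Reg q) ℂ :=
  (1 : Matrix (Reg 1 × Reg q) (Reg 1 × Reg q) ℂ).submatrix (S.final y).symm id

lemma isIsometry_finalMatrix (y : Y) : IsIsometry (S.finalMatrix y) :=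
  isIsometry_one.submatrix (S.final y).symm (Equiv.refl _)

lemma finalMatrix_mulVec_apply (y : Y) (ψ : Reg 1 × Reg q → ℂ) (i : Reg 1 × Reg q) :
    (S.finalMatrix y *ᵥ ψ) i = ψ ((S.final y).symm i) := by
  simp [finalMatrix, Matrix.mulVec, dotProduct, Matrix.one_apply]

/-- The operations of Bob. -/
def bobOp (k : ℕ) (y : Y) : Channel (Reg 1 × Reg q) (Reg 1 × Reg q) :=
  if k = S.turns then Channel.ofIsometry (S.finalMatrix y) (S.isIsometry_finalMatrix y)
  else Channel.ofIsometry (1 ⊗ₖ S.opBob y) (isIsometry_one.kronecker (S.opBob_isIsometry y))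

/-- The protocol given by the data `S`. -/
def protocol : Protocol X Y Z where
  rounds := S.turns + 1
  qA := fun _ => q
  qB := replySize q
  qB_zero := rfl
  al := { priv := fun _ => 0, op := S.alOp }
  bob := { priv := fun _ => 1, op := S.bobOp }
  al_unitary := fun k x => by cases k <;> rfl
  bob_unitary := fun k y => by
    change (S.bobOp k y).num = 1
    unfold bobOp
    split_ifs <;> rfl
  outAl := fun i => S.outAl i.2
  outBob := S.outBob

lemma communication_protocol : S.protocol.communication = (S.turns + 1) * (q + q) := by
  change ∑ _ ∈ Finset.range (S.turns + 1), (q + q) = _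
  rw [Finset.sum_const, Finset.card_range, smul_eq_mul]

lemma initOp_app (x : X) :
    (S.initOp x).app (blank 0 ⊗ₖ blank 0) = blank 0 ⊗ₖ proj (S.init x) := by
  rw [blank_eq_proj, ← proj_tensorVec, ← proj_tensorVec]
  refine (Channel.ofIsometry_app_proj _ (S.isIsometry_initMatrix x) _).trans (congrArg proj ?_)
  ext ⟨a, m⟩
  simp [Matrix.mulVec, dotProduct, Fintype.sum_subsingleton _ ((0, 0) : Reg 0 × Reg 0), tensorVec,
    initMatrix, Subsingleton.elim a 0]

lemma alOp_succ_app (k : ℕ) (x : X) (ρ : Matrix (Reg 0) (Reg 0) ℂ) (ψ : Reg q → ℂ) :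
    (S.alOp (k + 1) x).app (ρ ⊗ₖ proj ψ) = ρ ⊗ₖ proj (S.opAl k x *ᵥ ψ) :=
  Channel.ofIsometry_one_kronecker_app (S.opAl_isIsometry k x) ρ ψ

lemma bobOp_app {k : ℕ} (hk : k < S.turns) (y : Y) (ρ : Matrix (Reg 1) (Reg 1) ℂ)
    (ψ : Reg q → ℂ) : (S.bobOp k y).app (ρ ⊗ₖ proj ψ) = ρ ⊗ₖ proj (S.opBob y *ᵥ ψ) := by
  rw [bobOp, if_neg hk.ne, Channel.ofIsometry_one_kronecker_app (S.opBob_isIsometry y)]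

lemma bobOp_turns_app (y : Y) (ψ : Reg 1 × Reg q → ℂ) :
    (S.bobOp S.turns y).app (proj ψ) = proj (S.finalMatrix y *ᵥ ψ) := by
  rw [bobOp, if_pos rfl, Channel.ofIsometry_app_proj]

section AgainstBob

variable (B : Strategy Y S.protocol.qA fun k => S.protocol.qB (k + 1)) (x : X) (y : Y)

lemma runMid_al_zero :
    runMid S.protocol.al B x y 0 = (blank _ ⊗ₖ proj (S.msg x y 0)) ⊗ₖ blank 0 :=
  pass_act_of_app_eq (T := S.initOp x) (run_zero _ B x y) (S.initOp_app x)

lemma runMid_al_succ {k : ℕ} {σ : Matrix (Reg (B.priv (k + 1))) (Reg (B.priv (k + 1))) ℂ}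
    (h : run S.protocol.al B x y (k + 1) = (blank 0 ⊗ₖ proj (S.reply x y k)) ⊗ₖ σ) :
    runMid S.protocol.al B x y (k + 1) = (σ ⊗ₖ proj (S.msg x y (k + 1))) ⊗ₖ blank 0 :=
  pass_act_of_app_eq (T := S.alOp (k + 1) x) h (S.alOp_succ_app k x _ _)

end AgainstBob

lemma runMid_protocol (x : X) (y : Y) {k : ℕ} (hk : k ≤ S.turns) :
    runMid S.protocol.al S.protocol.bob x y k =
      (blank 1 ⊗ₖ proj (S.msg x y k)) ⊗ₖ blank 0 := by
  induction k with
  | zero => exact S.runMid_al_zero _ x y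
  | succ k ih =>
    exact S.runMid_al_succ _ x y
      (pass_act_of_app_eq (T := S.bobOp k y) (ih (by lia)) (S.bobOp_app (by lia) y _ _))

lemma msgAl_protocol (x : X) (y : Y) {k : ℕ} (hk : k ≤ S.turns) :
    msgAl S.protocol.al S.protocol.bob x y k = proj (S.msg x y k) := by
  rw [msgAl, S.runMid_protocol x y hk]
  exact (congrArg trFst ((isDensity_blank 0).trSnd_kronecker _)).trans
    ((isDensity_blank 1).trFst_kronecker _)

lemma msgBob_protocol (x : X) (y : Y) {k : ℕ} (hk : k < S.turns) :
    msgBob S.protocol.al S.protocol.bob x y k = proj (S.reply x y k) := by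
  refine (trFst_trSnd_pass_act (T := S.bobOp k y) (S.runMid_protocol x y hk.le)
    (isDensity_blank 0)).trans ?_
  rw [S.bobOp_app hk]
  exact (isDensity_blank 1).trFst_kronecker _

/-- No two states in which Bob receives the register, on different inputs of Al, are orthogonal,
except perhaps in Bob's last turn. -/
def MsgNonorthogonal : Prop :=
  ∀ k < S.turns, ∀ x x' y, star (S.msg x y k) ⬝ᵥ S.msg x' y k ≠ 0

/-- No two states in which Al gets the register back, on different inputs of Bob, are orthogonal,
except perhaps after Bob's last turn. -/
def ReplyNonorthogonal : Prop :=
  ∀ k < S.turns, ∀ x y y', star (S.reply x y k) ⬝ᵥ S.reply x y' k ≠ 0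

variable {S}

lemma exists_runMid_of_honestBob [Nonempty X] (hS : S.MsgNonorthogonal)
    {B : Strategy Y S.protocol.qA fun k => S.protocol.qB (k + 1)} {k : ℕ} (hk : k ≤ S.turns)
    (hB : S.protocol.HonestBob B k) :
    ∃ σ : Y → Matrix (Reg (B.priv k)) (Reg (B.priv k)) ℂ, (∀ y, IsDensity (σ y)) ∧
      ∀ x y, runMid S.protocol.al B x y k = (σ y ⊗ₖ proj (S.msg x y k)) ⊗ₖ blank 0 := by
  induction k with
  | zero => exact ⟨fun _ => blank _, fun _ => isDensity_blank _, fun x y => S.runMid_al_zero B x y⟩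
  | succ k ih =>
    obtain ⟨σ, hσ, hrun⟩ := ih (by lia) fun x y j hj => hB x y j (by lia)
    have hpure (x y) : trFst ((B.op k y).app (σ y ⊗ₖ proj (S.msg x y k))) =
        proj (S.reply x y k) :=
      (trFst_trSnd_pass_act (T := B.op k y) (hrun x y) (isDensity_blank 0)).symm.trans <|
        (hB x y k (by lia)).trans (S.msgBob_protocol x y hk)
    choose σ' hσ' hop using fun y => (B.op k y).exists_app_eq_kronecker_proj (hσ y)
      (fun x => S.msg_unit x y k) (fun x x' => hS k hk x x' y)
      (fun x x' => S.star_reply_dotProduct_reply x x' y k) (fun x => hpure x y)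
    exact ⟨σ', hσ', fun x y => S.runMid_al_succ B x y <|
      pass_act_of_app_eq (T := B.op k y) (hrun x y) (hop y x)⟩

lemma exists_runMid_zero_of_honestAl [Nonempty Y] {A : Strategy X S.protocol.qB S.protocol.qA}
    (hA : S.protocol.HonestAl A 1) :
    ∃ σ : X → Matrix (Reg (A.priv 1)) (Reg (A.priv 1)) ℂ, (∀ x, IsDensity (σ x)) ∧
      ∀ x y, runMid A S.protocol.bob x y 0 = (blank 1 ⊗ₖ proj (S.msg x y 0)) ⊗ₖ σ x := by
  have hone : star (Pi.single 0 1 : Reg 0 → ℂ) ⬝ᵥ Pi.single 0 1 = 1 := by simp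
  have hrun (x y) : run A S.protocol.bob x y 0 =
      (blank _ ⊗ₖ proj (Pi.single (0 : Reg 0) (1 : ℂ))) ⊗ₖ blank 1 :=
    blank_eq_proj 0 ▸ run_zero A S.protocol.bob x y
  have hpure (x y) : trFst ((A.op 0 x).app (blank _ ⊗ₖ proj (Pi.single (0 : Reg 0) (1 : ℂ)))) =
      proj (S.msg x y 0) :=
    (trFst_trSnd_pass_act (T := A.op 0 x) (hrun x y) (isDensity_blank 1)).symm.trans <|
      (hA x y 0 one_pos).trans (S.msgAl_protocol x y (Nat.zero_le _))
  choose σ hσ hop using fun x => (A.op 0 x).exists_app_eq_kronecker_proj (ι := Y)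
    (isDensity_blank _) (fun _ => hone) (fun _ _ => hone.trans_ne one_ne_zero)
    (fun _ _ => (S.init_unit x).trans hone.symm) (hpure x)
  exact ⟨σ, hσ, fun x y => pass_act_of_app_eq (T := A.op 0 x) (hrun x y) (hop x y)⟩

lemma exists_runMid_of_honestAl [Nonempty Y] (hS : S.ReplyNonorthogonal)
    {A : Strategy X S.protocol.qB S.protocol.qA} {k : ℕ} (hk : k ≤ S.turns)
    (hA : S.protocol.HonestAl A (k + 1)) :
    ∃ σ : X → Matrix (Reg (A.priv (k + 1))) (Reg (A.priv (k + 1))) ℂ, (∀ x, IsDensity (σ x)) ∧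
      ∀ x y, runMid A S.protocol.bob x y k = (blank 1 ⊗ₖ proj (S.msg x y k)) ⊗ₖ σ x := by
  induction k with
  | zero => exact exists_runMid_zero_of_honestAl hA
  | succ k ih =>
    obtain ⟨σ, hσ, hmid⟩ := ih (by lia) fun x y j hj => hA x y j (by lia)
    have hrun (x y) : run A S.protocol.bob x y (k + 1) =
        (σ x ⊗ₖ proj (S.reply x y k)) ⊗ₖ blank 1 :=
      pass_act_of_app_eq (T := S.bobOp k y) (hmid x y) (S.bobOp_app hk y _ _)
    have hpure (x y) : trFst ((A.op (k + 1) x).app (σ x ⊗ₖ proj (S.reply x y k))) =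
        proj (S.msg x y (k + 1)) :=
      (trFst_trSnd_pass_act (T := A.op (k + 1) x) (hrun x y) (isDensity_blank 1)).symm.trans <|
        (hA x y (k + 1) (by lia)).trans (S.msgAl_protocol x y hk)
    choose σ' hσ' hop using fun x => (A.op (k + 1) x).exists_app_eq_kronecker_proj (hσ x)
      (fun y => (S.star_reply_dotProduct_reply x x y k).trans (S.msg_unit x y k))
      (fun y y' => hS k hk x y y') (S.star_msg_succ_dotProduct_msg_succ x · · k) (hpure x)
    exact ⟨σ', hσ', fun x y => pass_act_of_app_eq (T := A.op (k + 1) x) (hrun x y) (hop x y)⟩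

section PrivacyLoss

lemma logb_card_reg (k : ℕ) : Real.logb 2 (Fintype.card (Reg k)) = k := by
  simp [Reg, Real.logb_pow]

variable [Fintype X] [DecidableEq X] [Fintype Y] [DecidableEq Y] [Fintype Z] [DecidableEq Z]
  {μ : X × Y → ℝ} {ν : Y × X → ℝ} {A : Strategy X S.protocol.qB S.protocol.qA}
  {B : Strategy Y S.protocol.qA fun k => S.protocol.qB (k + 1)} {k : ℕ}

lemma divulged_trSnd_run_le [Nonempty Y] (hS : S.ReplyNonorthogonal) (f : Y → X → Z)
    (hν : ν ∈ stdSimplex ℝ (Y × X)) (hk : k ≤ S.turns + 1) (hA : S.protocol.HonestAl A k) :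
    divulged f ν (fun y x => trSnd (run A S.protocol.bob x y k)) ≤ q := by
  cases k with
  | zero =>
    have hstate (y x) : trSnd (run A S.protocol.bob x y 0) = blank _ ⊗ₖ blank _ :=
      (congrArg trSnd (run_zero A _ x y)).trans ((isDensity_blank 1).trSnd_kronecker _)
    simp only [hstate]
    exact (divulged_const_nonpos f hν fun _ => (isDensity_blank _).kronecker
      (isDensity_blank _)).trans (Nat.cast_nonneg q)
  | succ k =>
    obtain ⟨σ, hσ, hmid⟩ := exists_runMid_of_honestAl hS (Nat.le_of_succ_le_succ hk) hA
    have hstate : (fun y x => trSnd (run A S.protocol.bob x y (k + 1))) = fun y x =>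
        σ x ⊗ₖ trFst ((S.bobOp k y).app (blank 1 ⊗ₖ proj (S.msg x y k))) :=
      funext₂ fun y x => trSnd_pass_act (T := S.bobOp k y) (hmid x y)
    rw [hstate, ← logb_card_reg q]
    exact divulged_kronecker_le f hν hσ fun y x => ((S.bobOp k y).isDensity_app
      ((isDensity_blank 1).kronecker (S.isDensity_msg x y k))).trFst

lemma divulged_trFst_runMid_le [Nonempty Y] (hS : S.ReplyNonorthogonal) (f : Y → X → Z)
    (hν : ν ∈ stdSimplex ℝ (Y × X)) (hk : k ≤ S.turns) (hA : S.protocol.HonestAl A (k + 1)) :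
    divulged f ν (fun y x => trFst (runMid A S.protocol.bob x y k)) ≤ q := by
  obtain ⟨σ, hσ, hmid⟩ := exists_runMid_of_honestAl hS hk hA
  have hstate : (fun y x => trFst (runMid A S.protocol.bob x y k)) = fun _ x => σ x :=
    funext₂ fun y x => (congrArg trFst (hmid x y)).trans
      (((isDensity_blank 1).kronecker (S.isDensity_msg x y k)).trFst_kronecker _)
  rw [hstate]
  exact (divulged_const_nonpos f hν hσ).trans (Nat.cast_nonneg q)

lemma divulged_trFst_run_le [Nonempty X] (hS : S.MsgNonorthogonal) (f : X → Y → Z)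
    (hμ : μ ∈ stdSimplex ℝ (X × Y)) (hk : k ≤ S.turns + 1) (hB : S.protocol.HonestBob B k) :
    divulged f μ (fun x y => trFst (run S.protocol.al B x y k)) ≤ q := by
  cases k with
  | zero =>
    have hstate (x y) : trFst (run S.protocol.al B x y 0) = blank _ :=
      (congrArg trFst (run_zero _ B x y)).trans
        (((isDensity_blank 0).kronecker (isDensity_blank 0)).trFst_kronecker _)
    simp only [hstate]
    exact (divulged_const_nonpos f hμ fun _ => isDensity_blank _).trans (Nat.cast_nonneg q)
  | succ k =>
    obtain ⟨σ, hσ, hmid⟩ := exists_runMid_of_honestBob hS (Nat.le_of_succ_le_succ hk)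
      fun x y j hj => hB x y j (by lia)
    have hstate : (fun x y => trFst (run S.protocol.al B x y (k + 1))) = fun x y =>
        trSnd ((B.op k y).app (σ y ⊗ₖ proj (S.msg x y k))) :=
      funext₂ fun x y => trFst_pass_act (T := B.op k y) (hmid x y) (isDensity_blank 0)
    rw [hstate, ← logb_card_reg q]
    exact divulged_trSnd_app_le f hμ (B.op k) hσ fun x y => S.isDensity_msg x y k

lemma divulged_trSnd_runMid_le [Nonempty X] (hS : S.MsgNonorthogonal) (f : X → Y → Z)
    (hμ : μ ∈ stdSimplex ℝ (X × Y)) (hk : k ≤ S.turns) (hB : S.protocol.HonestBob B k) :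
    divulged f μ (fun x y => trSnd (runMid S.protocol.al B x y k)) ≤ q := by
  obtain ⟨σ, hσ, hmid⟩ := exists_runMid_of_honestBob hS hk hB
  have hstate : (fun x y => trSnd (runMid S.protocol.al B x y k)) =
      fun x y => σ y ⊗ₖ proj (S.msg x y k) :=
    funext₂ fun x y => (congrArg trSnd (hmid x y)).trans ((isDensity_blank 0).trSnd_kronecker _)
  rw [hstate, ← logb_card_reg q]
  exact divulged_kronecker_le f hμ hσ fun x y => S.isDensity_msg x y k

theorem privacyLossLE_protocol [Nonempty X] [Nonempty Y] (hA : S.ReplyNonorthogonal)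
    (hB : S.MsgNonorthogonal) (f : X → Y → Z) : S.protocol.PrivacyLossLE f q := by
  intro μ hμ
  have hswap : (fun p : Y × X => μ p.swap) ∈ stdSimplex ℝ (Y × X) :=
    ⟨fun p => hμ.1 p.swap, ((Equiv.prodComm Y X).sum_comp μ).trans hμ.2⟩
  exact ⟨fun A k => ⟨divulged_trSnd_run_le hA _ hswap,
      fun hk => divulged_trFst_runMid_le hA _ hswap (Nat.le_of_lt_succ hk)⟩,
    fun B k => ⟨divulged_trFst_run_le hB f hμ,
      fun hk => divulged_trSnd_runMid_le hB f hμ (Nat.le_of_lt_succ hk)⟩⟩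

end PrivacyLoss

section Output

variable (S) (x : X) (y : Y)

lemma run_rounds_apply_self (a : Reg 0) (m : Reg q) (b : Reg 1) :
    run S.protocol.al S.protocol.bob x y (S.turns + 1) ((a, m), b) ((a, m), b) =
      Complex.normSq (tensorVec (Pi.single 0 1) (S.msg x y S.turns)
        ((S.final y).symm (b, m))) := by
  set ψ : Reg 1 × Reg q → ℂ := tensorVec (Pi.single 0 1) (S.msg x y S.turns)
  have happ : (S.bobOp S.turns y).app (blank 1 ⊗ₖ proj (S.msg x y S.turns)) =
      proj (S.finalMatrix y *ᵥ ψ) := by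
    rw [blank_eq_proj, ← proj_tensorVec, bobOp_turns_app]
  have hrun : run S.protocol.al S.protocol.bob x y (S.turns + 1) =
      pass (proj (S.finalMatrix y *ᵥ ψ) ⊗ₖ blank 0) := by
    rw [← happ]
    exact congrArg pass ((congrArg _ (S.runMid_protocol x y le_rfl)).trans
      ((S.bobOp S.turns y).act_kronecker _ _))
  rw [hrun]
  change proj (S.finalMatrix y *ᵥ ψ) (b, m) (b, m) * blank 0 a a = _
  rw [blank, Subsingleton.elim a 0, Matrix.single_apply_same, mul_one, proj_apply,
    finalMatrix_mulVec_apply, Complex.star_def, Complex.mul_conj]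

open Classical in
theorem outputProb_protocol (z : Z) :
    S.protocol.outputProb x y z = ∑ s,
      if S.outAl (S.final y (0, s)).2 = z ∧ S.outBob (S.final y (0, s)).1 = z
      then Complex.normSq (S.msg x y S.turns s) else 0 := by
  set p : Reg 1 × Reg q → ℝ := fun w => if S.outAl w.2 = z ∧ S.outBob w.1 = z then
    Complex.normSq (tensorVec (Pi.single 0 1) (S.msg x y S.turns) ((S.final y).symm w)) else 0
  have hsum : S.protocol.outputProb x y z = ∑ a : Reg 0, ∑ m, ∑ b, p (b, m) := by
    refine (Fintype.sum_prod_type _).trans ((Fintype.sum_prod_type _).trans ?_)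
    refine Finset.sum_congr rfl fun a _ => Finset.sum_congr rfl fun m _ =>
      Finset.sum_congr rfl fun b _ => if_congr Iff.rfl ?_ rfl
    exact congrArg Complex.re (S.run_rounds_apply_self x y a m b)
  rw [hsum, Fintype.sum_unique, Finset.sum_comm, ← Fintype.sum_prod_type,
    ← Equiv.sum_comp (S.final y), Fintype.sum_prod_type, Finset.sum_eq_single 0]
  · simp [p, tensorVec]
  · intro b _ hb
    simp [p, tensorVec, hb]
  · simp

end Output

end PingPong

/-! ### The search for a common element -/

section Diffusion

variable {I : Type*} [DecidableEq I]

/-- Add the membership bit of the index to the flag. -/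
def flagPerm (x : Finset I) : Equiv.Perm (I × Bool) :=
  Function.Involutive.toPerm (fun s => (s.1, s.2 ^^ decide (s.1 ∈ x))) fun s => by
    ext <;> simp

/-- The amplitudes `w` on the indices, with the flag telling membership in `x`. -/
def flagged (x : Finset I) (w : I → ℂ) : I × Bool → ℂ :=
  tensorVec w (Pi.single false 1) ∘ flagPerm x

lemma flagged_apply (x : Finset I) (w : I → ℂ) (s : I × Bool) :
    flagged x w s = if s.2 = decide (s.1 ∈ x) then w s.1 else 0 := by
  change w s.1 * (Pi.single false 1 : Bool → ℂ) (s.2 ^^ decide (s.1 ∈ x)) = _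
  cases s.2 <;> cases decide (s.1 ∈ x) <;> simp

variable [Fintype I]

/-- The inversion about the mean. -/
def diffusion (I : Type*) [Fintype I] [DecidableEq I] : Matrix I I ℂ :=
  (2 / Fintype.card I : ℂ) • Matrix.of (fun _ _ => 1) - 1

lemma diffusion_mulVec (w : I → ℂ) (i : I) :
    (diffusion I *ᵥ w) i = 2 / Fintype.card I * ∑ i', w i' - w i := by
  rw [diffusion, Matrix.sub_mulVec, Matrix.smul_mulVec, Matrix.one_mulVec]
  simp [Matrix.mulVec, dotProduct]

lemma isIsometry_diffusion : IsIsometry (diffusion I) := by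
  have hstar : (diffusion I)ᴴ = diffusion I := by
    ext i j
    simp [diffusion, Matrix.one_apply, eq_comm]
  refine Matrix.ext_of_mulVec_single fun j => funext fun i => ?_
  have : Nonempty I := ⟨j⟩
  have hI : (Fintype.card I : ℂ) ≠ 0 := by exact_mod_cast Fintype.card_ne_zero
  rw [hstar, ← Matrix.mulVec_mulVec, diffusion_mulVec, Matrix.one_mulVec]
  simp only [diffusion_mulVec, Finset.sum_sub_distrib, Finset.sum_const, Finset.card_univ,
    nsmul_eq_mul]
  field_simp
  ring

/-- The diffusion step of Al, who clears the flag before it and restores the flag after it. -/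
def alStep (x : Finset I) : Matrix (I × Bool) (I × Bool) ℂ :=
  (diffusion I ⊗ₖ (1 : Matrix Bool Bool ℂ)).submatrix (flagPerm x) (flagPerm x)

lemma isIsometry_alStep (x : Finset I) : IsIsometry (alStep x) :=
  (isIsometry_diffusion.kronecker isIsometry_one).submatrix _ _

lemma alStep_mulVec_flagged (x : Finset I) (w : I → ℂ) :
    alStep x *ᵥ flagged x w = flagged x (diffusion I *ᵥ w) := by
  rw [alStep, flagged, submatrix_mulVec_comp, kronecker_mulVec_tensorVec, Matrix.one_mulVec,
    flagged]

end Diffusion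

/-- The basis states of one run of the search: an index, a flag that tells Bob whether the index
belongs to Al's set, and the number of iterations that the run performs. -/
abbrev Cell (M : ℕ) (I : Type*) : Type _ := (I × Bool) × Fin M

section Run

/-- The amplitudes of the uniform superposition over the indices and the numbers of iterations. -/
def amp (M : ℕ) (I : Type*) [Fintype I] : ℝ := (√(M * Fintype.card I))⁻¹

lemma amp_sq (M : ℕ) (I : Type*) [Fintype I] : amp M I ^ 2 = ((M : ℝ) * Fintype.card I)⁻¹ := by
  rw [amp, inv_pow, Real.sq_sqrt (by positivity)]

variable {M : ℕ} {I : Type*} [DecidableEq I]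

/-- The index belongs to Al's set, according to the flag, and to Bob's set `y`. -/
def good (y : Finset I) (s : Cell M I) : Bool := s.1.2 && decide (s.1.1 ∈ y)

/-- Bob's operation: multiply the common elements by the phase `ω`. -/
def bobMatrix (M : ℕ) (ω : Circle) (y : Finset I) : Matrix (Cell M I) (Cell M I) ℂ :=
  Matrix.diagonal fun s => if good y s then (ω : ℂ) else 1

lemma bobMatrix_one (y : Finset I) : bobMatrix M 1 y = 1 := by
  simp [bobMatrix]

variable [Fintype I]

lemma blockDiagonal_mulVec {m o : Type*} [Fintype m] [Fintype o] [DecidableEq o]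
    (B : o → Matrix m m ℂ) (v : m × o → ℂ) (s : m × o) :
    (Matrix.blockDiagonal B *ᵥ v) s = (B s.2 *ᵥ fun i => v (i, s.2)) s.1 := by
  simp [Matrix.mulVec, dotProduct, Fintype.sum_prod_type, Matrix.blockDiagonal_apply]

/-- Al's operation after `k` iterations. -/
def alMatrix (M k : ℕ) (x : Finset I) : Matrix (Cell M I) (Cell M I) ℂ :=
  Matrix.blockDiagonal fun j : Fin M => if k < j then alStep x else 1

lemma isIsometry_alMatrix (k : ℕ) (x : Finset I) : IsIsometry (alMatrix M k x) := by
  have hblock : ∀ j : Fin M, IsIsometry (if k < j then alStep x else 1) := fun j => by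
    split_ifs
    · exact isIsometry_alStep x
    · exact isIsometry_one
  rw [IsIsometry, alMatrix, Matrix.blockDiagonal_conjTranspose, ← Matrix.blockDiagonal_mul]
  exact (congrArg _ (funext hblock)).trans Matrix.blockDiagonal_one

lemma isIsometry_bobMatrix (ω : Circle) (y : Finset I) : IsIsometry (bobMatrix M ω y) := by
  rw [IsIsometry, bobMatrix, Matrix.diagonal_conjTranspose, Matrix.diagonal_mul_diagonal,
    ← Matrix.diagonal_one]
  congr 1
  ext s
  rw [Pi.star_apply]
  split_ifs
  · rw [Complex.star_def, ← Complex.normSq_eq_conj_mul_self, Circle.normSq_coe, Complex.ofReal_one]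
  · simp

/-- The first message. -/
def initVec (M : ℕ) (x : Finset I) : Cell M I → ℂ :=
  fun s => flagged x (fun _ => (amp M I : ℂ)) s.1

lemma star_initVec_dotProduct_initVec [NeZero M] (x x' : Finset I) :
    star (initVec M x) ⬝ᵥ initVec M x' =
      (Finset.card {i | i ∈ x ↔ i ∈ x'} : ℂ) / Fintype.card I := by
  have hterm : ∀ i, ∑ b, star (flagged x (fun _ => (amp M I : ℂ)) (i, b)) *
      flagged x' (fun _ => (amp M I : ℂ)) (i, b) =
        if i ∈ x ↔ i ∈ x' then ((amp M I ^ 2 : ℝ) : ℂ) else 0 := fun i => by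
    by_cases hx : i ∈ x <;> by_cases hx' : i ∈ x' <;> simp [flagged_apply, hx, hx', sq]
  have hM : (M : ℂ) ≠ 0 := by exact_mod_cast NeZero.ne M
  simp only [dotProduct, Fintype.sum_prod_type_right, Pi.star_apply, initVec]
  rw [← Fintype.sum_prod_type_right (fun s : I × Bool => star (flagged x _ s) * flagged x' _ s),
    Fintype.sum_prod_type]
  simp only [hterm]
  rw [← Finset.sum_filter]
  simp only [Finset.sum_const, amp_sq, Finset.card_univ, Fintype.card_fin, nsmul_eq_mul]
  push_cast
  field_simp

/-- The state of one run after `k` iterations. -/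
def vec (M : ℕ) (ω : Circle) (x y : Finset I) : ℕ → Cell M I → ℂ
  | 0 => initVec M x
  | k + 1 => alMatrix M k x *ᵥ (bobMatrix M ω y *ᵥ vec M ω x y k)

/-- The phases by which an iteration multiplies the indices if the common elements are `t`. -/
def phase (ω : Circle) (t : Finset I) (i : I) : ℂ := if i ∈ t then ω else 1

/-- The amplitudes on the indices after `k` iterations if the common elements are `t`, in the part
of the state that performs `j` iterations. -/
def coef (M : ℕ) (ω : Circle) (t : Finset I) : ℕ → ℕ → I → ℂ
  | 0, _ => fun _ => amp M I
  | k + 1, j =>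
    if k < j then diffusion I *ᵥ (phase ω t * coef M ω t k j) else phase ω t * coef M ω t k j

lemma bobMatrix_mulVec_flagged (ω : Circle) (x y : Finset I) (w : Fin M → I → ℂ) :
    bobMatrix M ω y *ᵥ (fun s => flagged x (w s.2) s.1) =
      fun s => flagged x (phase ω (x ∩ y) * w s.2) s.1 := by
  ext s
  rw [bobMatrix, Matrix.mulVec_diagonal, flagged_apply, flagged_apply]
  by_cases hs : s.1.2 = decide (s.1.1 ∈ x)
  · simp [hs, good, phase]
  · simp [hs]

lemma alMatrix_mulVec_flagged (k : ℕ) (x : Finset I) (w : Fin M → I → ℂ) :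
    alMatrix M k x *ᵥ (fun s => flagged x (w s.2) s.1) =
      fun s => flagged x (if k < s.2 then diffusion I *ᵥ w s.2 else w s.2) s.1 := by
  ext s
  rw [alMatrix, blockDiagonal_mulVec]
  change ((if k < s.2 then alStep x else 1) *ᵥ flagged x (w s.2)) s.1 = _
  split_ifs
  · rw [alStep_mulVec_flagged]
  · rw [Matrix.one_mulVec]

lemma vec_eq_flagged (ω : Circle) (x y : Finset I) (k : ℕ) :
    vec M ω x y k = fun s => flagged x (coef M ω (x ∩ y) k s.2) s.1 := by
  induction k with
  | zero => rfl
  | succ k ih =>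
    ext s
    rw [vec, ih, bobMatrix_mulVec_flagged ω x y fun j => coef M ω (x ∩ y) k j,
      alMatrix_mulVec_flagged k x fun j => phase ω (x ∩ y) * coef M ω (x ∩ y) k j]
    rfl

lemma coef_one (t : Finset I) (k j : ℕ) : coef M 1 t k j = fun _ => (amp M I : ℂ) := by
  have hphase : phase 1 t = 1 := funext fun i => by simp [phase]
  induction k with
  | zero => rfl
  | succ k ih =>
    rw [coef, ih, hphase, one_mul, ite_eq_right_iff]
    refine fun _ => funext fun i => ?_
    have : Nonempty I := ⟨i⟩
    have hI : (Fintype.card I : ℂ) ≠ 0 := by exact_mod_cast Fintype.card_ne_zero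
    rw [diffusion_mulVec, Finset.sum_const, Finset.card_univ, nsmul_eq_mul]
    field_simp
    ring

lemma vec_one (x y : Finset I) (k : ℕ) : vec M 1 x y k = initVec M x := by
  simp only [vec_eq_flagged, coef_one]
  rfl

lemma vec_unit [NeZero M] [Nonempty I] (ω : Circle) (x y : Finset I) (k : ℕ) :
    star (vec M ω x y k) ⬝ᵥ vec M ω x y k = 1 := by
  induction k with
  | zero => simp [vec, star_initVec_dotProduct_initVec]
  | succ k ih =>
    rw [vec, (isIsometry_alMatrix k x).star_mulVec_dotProduct_mulVec,
      (isIsometry_bobMatrix ω y).star_mulVec_dotProduct_mulVec, ih]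

/-- The probability that measuring one run after `k` iterations yields a common element. -/
def success (M : ℕ) (ω : Circle) (x y : Finset I) (k : ℕ) : ℝ :=
  ∑ s : Cell M I, if good y s then Complex.normSq (vec M ω x y k s) else 0

lemma sum_normSq_vec [NeZero M] [Nonempty I] (ω : Circle) (x y : Finset I) (k : ℕ) :
    ∑ s, Complex.normSq (vec M ω x y k s) = 1 := by
  have hunit := congrArg Complex.re (vec_unit (M := M) ω x y k)
  simpa [dotProduct, Complex.normSq_apply] using hunit

lemma success_le_one [NeZero M] [Nonempty I] (ω : Circle) (x y : Finset I) (k : ℕ) :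
    success M ω x y k ≤ 1 := by
  rw [← sum_normSq_vec (M := M) ω x y k, success]
  gcongr with s
  split_ifs
  · exact le_rfl
  · exact Complex.normSq_nonneg _

lemma normSq_coef_of_le (ω : Circle) (t : Finset I) {j k : ℕ} (h : j ≤ k) (i : I) :
    Complex.normSq (coef M ω t k j i) = Complex.normSq (coef M ω t j j i) := by
  have hphase : Complex.normSq (phase ω t i) = 1 := by
    unfold phase
    split_ifs <;> simp
  induction k, h using Nat.le_induction with
  | base => rfl
  | succ k hk ih =>
    rw [coef, if_neg (by lia), Pi.mul_apply, Complex.normSq_mul, hphase, ih, one_mul]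

lemma success_eq_sum (ω : Circle) (x y : Finset I) {k : ℕ} (hk : M ≤ k + 1) :
    success M ω x y k =
      ∑ j : Fin M, ∑ i ∈ x ∩ y, Complex.normSq (coef M ω (x ∩ y) j j i) := by
  rw [success, Fintype.sum_prod_type_right]
  refine Finset.sum_congr rfl fun j _ => ?_
  have hterm : ∀ i, ∑ b, (if good y ((i, b), j)
      then Complex.normSq (vec M ω x y k ((i, b), j)) else 0) =
        if i ∈ x ∩ y then Complex.normSq (coef M ω (x ∩ y) j j i) else 0 := fun i => by
    rw [← normSq_coef_of_le ω _ (by lia : j.1 ≤ k), vec_eq_flagged]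
    by_cases hx : i ∈ x <;> by_cases hy : i ∈ y <;> simp [good, flagged_apply, hx, hy]
  rw [Fintype.sum_prod_type]
  simp only [hterm, Finset.sum_ite_mem, Finset.univ_inter]

lemma success_eq_zero {x y : Finset I} (h : Disjoint x y) (ω : Circle) {k : ℕ} (hk : M ≤ k + 1) :
    success M ω x y k = 0 := by
  rw [success_eq_sum ω x y hk, Finset.disjoint_iff_inter_eq_empty.1 h]
  simp

end Run

lemma sum_cos_mul_two_mul_sin (α : ℝ) (m : ℕ) :
    (∑ j ∈ Finset.range m, Real.cos ((2 * j + 1) * α)) * (2 * Real.sin α) =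
      Real.sin (2 * m * α) := by
  induction m with
  | zero => simp
  | succ m ih =>
    have hsub : 2 * (m : ℝ) * α = (2 * m + 1) * α - α := by ring
    have hadd : 2 * ((m + 1 : ℕ) : ℝ) * α = (2 * m + 1) * α + α := by push_cast; ring
    rw [Finset.sum_range_succ, add_mul, ih, hsub, hadd, Real.sin_sub, Real.sin_add]
    ring

section NegOne

variable {M : ℕ} {I : Type*} [DecidableEq I] {φ : ℝ}

/-- The amplitudes, up to normalization, when the common elements `t` and the other indices make an
angle `φ` with each other and the state has been rotated to the angle `a`. -/
def angleVec (t : Finset I) (φ a : ℝ) (i : I) : ℝ :=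
  if i ∈ t then Real.sin a / Real.sin φ else Real.cos a / Real.cos φ

lemma two_mul_cos_sub_angleVec {t : Finset I} (hsin : Real.sin φ ≠ 0) (hcos : Real.cos φ ≠ 0)
    (a : ℝ) (i : I) :
    2 * Real.cos a - (if i ∈ t then -1 else 1) * angleVec t φ (a - φ) i =
      angleVec t φ (a + φ) i := by
  unfold angleVec
  split_ifs
  · rw [Real.sin_add, Real.sin_sub]
    field_simp
    ring
  · rw [Real.cos_add, Real.cos_sub]
    field_simp
    ring

variable [Fintype I]

lemma sum_phase_neg_one_mul_angleVec {t : Finset I}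
    (ht : (t.card : ℝ) = Fintype.card I * Real.sin φ ^ 2) (a : ℝ) :
    ∑ i, (if i ∈ t then -1 else 1) * angleVec t φ (a - φ) i = Fintype.card I * Real.cos a := by
  have hcompl : (tᶜ.card : ℝ) = Fintype.card I * Real.cos φ ^ 2 := by
    rw [Finset.card_compl, Nat.cast_sub t.card_le_univ, ht, Real.cos_sq']
    ring
  have hin : ∀ i ∈ t, (if i ∈ t then -1 else 1) * angleVec t φ (a - φ) i =
      -(Real.sin (a - φ) / Real.sin φ) := fun i hi => by simp [angleVec, hi]
  have hout : ∀ i ∈ tᶜ, (if i ∈ t then -1 else 1) * angleVec t φ (a - φ) i =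
      Real.cos (a - φ) / Real.cos φ := fun i hi => by
    simp [angleVec, Finset.mem_compl.1 hi]
  rw [← Finset.sum_add_sum_compl t, Finset.sum_congr rfl hin, Finset.sum_congr rfl hout,
    Finset.sum_const, Finset.sum_const, nsmul_eq_mul, nsmul_eq_mul, ht, hcompl]
  calc _ = Fintype.card I * Real.cos (a - φ + φ) := by
        rw [Real.cos_add]
        field_simp
        ring
    _ = _ := by rw [sub_add_cancel]

lemma coef_neg_one {t : Finset I} (hsin : Real.sin φ ≠ 0) (hcos : Real.cos φ ≠ 0)
    (ht : (t.card : ℝ) = Fintype.card I * Real.sin φ ^ 2) {k j : ℕ} (hk : k ≤ j) (i : I) :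
    coef M (-1) t k j i = ((amp M I * angleVec t φ ((2 * k + 1) * φ) i : ℝ) : ℂ) := by
  induction k generalizing i with
  | zero => simp [coef, angleVec, hsin, hcos]
  | succ k ih =>
    have : Nonempty I := ⟨i⟩
    have hI : (Fintype.card I : ℝ) ≠ 0 := by exact_mod_cast Fintype.card_ne_zero
    set a : ℝ := (2 * k + 2) * φ with ha
    have hprev : (2 * (k : ℝ) + 1) * φ = a - φ := by rw [ha]; ring
    have hnext : (2 * ((k + 1 : ℕ) : ℝ) + 1) * φ = a + φ := by rw [ha]; push_cast; ring
    have hphase : phase (-1) t * coef M (-1) t k j = fun i =>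
        ((amp M I * ((if i ∈ t then -1 else 1) * angleVec t φ (a - φ) i) : ℝ) : ℂ) := by
      ext i
      rw [Pi.mul_apply, ih (by lia), hprev, phase]
      split_ifs <;> simp
    rw [coef, if_pos (by lia), hphase, diffusion_mulVec, hnext,
      ← two_mul_cos_sub_angleVec hsin hcos, ← Complex.ofReal_sum, ← Finset.mul_sum,
      sum_phase_neg_one_mul_angleVec ht]
    push_cast
    have hI' : (Fintype.card I : ℂ) ≠ 0 := by exact_mod_cast hI
    field_simp

lemma sum_normSq_coef_neg_one [Nonempty I] {t : Finset I} (hsin : Real.sin φ ≠ 0)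
    (hcos : Real.cos φ ≠ 0) (ht : (t.card : ℝ) = Fintype.card I * Real.sin φ ^ 2)
    (j : ℕ) :
    ∑ i ∈ t, Complex.normSq (coef M (-1) t j j i) =
      (M : ℝ)⁻¹ * (1 / 2 - Real.cos ((2 * j + 1) * (2 * φ)) / 2) := by
  have hterm : ∀ i ∈ t, Complex.normSq (coef M (-1) t j j i) =
      amp M I ^ 2 * (Real.sin ((2 * j + 1) * φ) / Real.sin φ) ^ 2 := fun i hi => by
    rw [coef_neg_one hsin hcos ht le_rfl, Complex.normSq_ofReal, angleVec, if_pos hi]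
    ring
  have hI : (Fintype.card I : ℝ) ≠ 0 := by exact_mod_cast Fintype.card_ne_zero
  rw [Finset.sum_congr rfl hterm, Finset.sum_const, nsmul_eq_mul, amp_sq, ht, mul_left_comm _ 2 φ,
    Real.cos_two_mul, Real.cos_sq']
  field_simp
  ring

/-- The formula of Boyer, Brassard, Høyer and Tapp for a random number of iterations. -/
lemma success_neg_one [NeZero M] [Nonempty I] {x y : Finset I} (hsin : Real.sin φ ≠ 0)
    (hcos : Real.cos φ ≠ 0) (ht : ((x ∩ y).card : ℝ) = Fintype.card I * Real.sin φ ^ 2)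
    {k : ℕ} (hk : M ≤ k + 1) :
    success M (-1) x y k =
      1 / 2 - Real.sin (2 * M * (2 * φ)) / (4 * (M * Real.sin (2 * φ))) := by
  have hM : (M : ℝ) ≠ 0 := by exact_mod_cast NeZero.ne M
  have hsin2 : Real.sin (2 * φ) ≠ 0 := by
    rw [Real.sin_two_mul]
    exact mul_ne_zero (mul_ne_zero two_ne_zero hsin) hcos
  rw [success_eq_sum _ _ _ hk, ← sum_cos_mul_two_mul_sin]
  simp only [sum_normSq_coef_neg_one hsin hcos ht]
  rw [Fin.sum_univ_eq_sum_range fun j => (M : ℝ)⁻¹ * (1 / 2 - Real.cos ((2 * j + 1) * (2 * φ)) / 2),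
    ← Finset.mul_sum, Finset.sum_sub_distrib, Finset.sum_const, Finset.card_range, nsmul_eq_mul,
    ← Finset.sum_div]
  generalize ∑ j ∈ Finset.range M, Real.cos ((2 * j + 1) * (2 * φ)) = C
  field_simp
  ring

lemma exists_eq_mul_sin_sq {t N : ℝ} (ht : 0 < t) (htN : t < N) :
    ∃ φ, 0 < Real.sin φ ∧ 0 < Real.cos φ ∧ t = N * Real.sin φ ^ 2 := by
  have hN : 0 < N := ht.trans htN
  have hu0 : 0 < √(t / N) := Real.sqrt_pos.2 (div_pos ht hN)
  have hu1 : √(t / N) < 1 := by rw [Real.sqrt_lt' one_pos, one_pow, div_lt_one hN]; exact htN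
  refine ⟨Real.arcsin √(t / N), ?_, ?_, ?_⟩
  · rwa [Real.sin_arcsin (by linarith) hu1.le]
  · refine Real.cos_pos_of_mem_Ioo ⟨?_, Real.arcsin_lt_pi_div_two.2 hu1⟩
    exact Real.neg_pi_div_two_lt_arcsin.2 (by linarith)
  · rw [Real.sin_arcsin (by linarith) hu1.le, Real.sq_sqrt (by positivity)]
    field_simp

lemma le_success_neg_one {x y : Finset I} (hM : 16 * Fintype.card I ≤ M ^ 2)
    (h0 : ¬ Disjoint x y) (h2 : 2 * (x ∩ y).card ≤ Fintype.card I) {k : ℕ} (hk : M ≤ k + 1) :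
    7 / 16 ≤ success M (-1) x y k := by
  have h0' : 1 ≤ (x ∩ y).card := by
    rwa [Nat.one_le_iff_ne_zero, Finset.card_ne_zero, ← Finset.not_disjoint_iff_nonempty_inter]
  have : NeZero M := ⟨by rintro rfl; lia⟩
  have : Nonempty I := Fintype.card_pos_iff.1 (by lia)
  have h1 : (1 : ℝ) ≤ (x ∩ y).card := by exact_mod_cast h0'
  have h2' : 2 * ((x ∩ y).card : ℝ) ≤ Fintype.card I := by exact_mod_cast h2
  have hM' : 16 * (Fintype.card I : ℝ) ≤ M ^ 2 := by exact_mod_cast hM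
  obtain ⟨φ, hsin, hcos, ht⟩ := exists_eq_mul_sin_sq (t := (x ∩ y).card) (N := Fintype.card I)
    (by linarith) (by linarith)
  have hsin2 : 4 ≤ M * Real.sin (2 * φ) := by
    have hpos : 0 < Real.sin (2 * φ) := by
      rw [Real.sin_two_mul]
      positivity
    have hsq : 4 ^ 2 ≤ (M * Real.sin (2 * φ)) ^ 2 := by
      rw [mul_pow, Real.sin_two_mul]
      nlinarith [Real.sin_sq_add_cos_sq φ, mul_pos (pow_pos hsin 2) (pow_pos hcos 2)]
    exact (sq_le_sq₀ (by norm_num) (by positivity)).1 hsq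
  rw [success_neg_one hsin.ne' hcos.ne' ht hk]
  have hle : Real.sin (2 * M * (2 * φ)) / (4 * (M * Real.sin (2 * φ))) ≤ 1 / 16 := by
    rw [div_le_iff₀ (by positivity)]
    linarith [Real.sin_le_one (2 * M * (2 * φ))]
  linarith

end NegOne

section Phase

open Filter Topology

lemma analyticAt_circle_exp (θ : ℝ) : AnalyticAt ℝ (fun θ : ℝ => (Circle.exp θ : ℂ)) θ := by
  simp only [Circle.coe_exp]
  exact (analyticAt_cexp.restrictScalars (𝕜 := ℝ)).fun_comp
    ((Complex.ofRealCLM.analyticAt θ).mul analyticAt_const)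

lemma eventually_star_dotProduct_ne_zero {κ : Type*} [Fintype κ] {u v : ℝ → κ → ℂ}
    (hu : ∀ θ, AnalyticAt ℝ u θ) (hv : ∀ θ, AnalyticAt ℝ v θ)
    {θ₀ : ℝ} (h : star (u θ₀) ⬝ᵥ v θ₀ ≠ 0) (θ : ℝ) :
    ∀ᶠ z in 𝓝[≠] θ, star (u z) ⬝ᵥ v z ≠ 0 := by
  have hf : AnalyticOnNhd ℝ (fun θ => star (u θ) ⬝ᵥ v θ) Set.univ := fun θ _ => by
    refine Finset.analyticAt_fun_sum _ fun s _ => AnalyticAt.mul ?_ (analyticAt_pi_iff.1 (hv θ) s)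
    exact (Complex.conjCLE.toContinuousLinearMap.analyticAt _).fun_comp
      (analyticAt_pi_iff.1 (hu θ) s)
  refine (hf θ (Set.mem_univ θ)).eventually_eq_zero_or_eventually_ne_zero.resolve_left
    fun hzero => h ?_
  exact hf.eqOn_zero_of_preconnected_of_eventuallyEq_zero isPreconnected_univ
    (Set.mem_univ θ) hzero (Set.mem_univ θ₀)

variable {M : ℕ} {I : Type*} [DecidableEq I] [Fintype I]

lemma analyticAt_bobMatrix_mulVec (y : Finset I) {u : ℝ → Cell M I → ℂ} {θ : ℝ}
    (hu : AnalyticAt ℝ u θ) :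
    AnalyticAt ℝ (fun θ => bobMatrix M (Circle.exp θ) y *ᵥ u θ) θ := by
  refine analyticAt_pi_iff.2 fun s => ?_
  simp only [bobMatrix, Matrix.mulVec_diagonal]
  refine AnalyticAt.mul ?_ (analyticAt_pi_iff.1 hu s)
  split_ifs
  · exact analyticAt_circle_exp θ
  · exact analyticAt_const

lemma analyticAt_vec (x y : Finset I) (k : ℕ) (θ : ℝ) :
    AnalyticAt ℝ (fun θ => vec M (Circle.exp θ) x y k) θ := by
  induction k with
  | zero => exact analyticAt_const
  | succ k ih =>
    exact (((alMatrix M k x).mulVecLin.restrictScalars ℝ).toContinuousLinearMap.analyticAt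
      _).fun_comp (analyticAt_bobMatrix_mulVec y ih)

lemma continuous_success (x y : Finset I) (k : ℕ) :
    Continuous fun θ => success M (Circle.exp θ) x y k := by
  have hvec : Continuous fun θ => vec M (Circle.exp θ) x y k :=
    continuous_iff_continuousAt.2 fun θ => (analyticAt_vec x y k θ).continuousAt
  refine continuous_finsetSum _ fun s _ => ?_
  split_ifs
  · exact Complex.continuous_normSq.comp ((continuous_apply s).comp hvec)
  · exact continuous_const

lemma eventually_vec_nonorthogonal [NeZero M] {x x' : Finset I} (h : ∃ i, i ∈ x ↔ i ∈ x')
    (y : Finset I) (k : ℕ) (θ : ℝ) :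
    ∀ᶠ z in 𝓝[≠] θ,
      star (vec M (Circle.exp z) x y k) ⬝ᵥ vec M (Circle.exp z) x' y k ≠ 0 := by
  refine eventually_star_dotProduct_ne_zero (analyticAt_vec x y k) (analyticAt_vec x' y k)
    (θ₀ := 0) ?_ θ
  obtain ⟨i, hi⟩ := h
  have : Nonempty I := ⟨i⟩
  rw [Circle.exp_zero, vec_one, vec_one, star_initVec_dotProduct_initVec]
  refine div_ne_zero ?_ (by exact_mod_cast Fintype.card_ne_zero)
  exact_mod_cast Finset.card_ne_zero.2 ⟨i, by simpa using hi⟩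

lemma eventually_bobMatrix_mulVec_nonorthogonal [NeZero M] [Nonempty I] (x y y' : Finset I)
    (k : ℕ) (θ : ℝ) :
    ∀ᶠ z in 𝓝[≠] θ, star (bobMatrix M (Circle.exp z) y *ᵥ vec M (Circle.exp z) x y k) ⬝ᵥ
      (bobMatrix M (Circle.exp z) y' *ᵥ vec M (Circle.exp z) x y' k) ≠ 0 := by
  refine eventually_star_dotProduct_ne_zero
    (fun θ => analyticAt_bobMatrix_mulVec y (analyticAt_vec x y k θ))
    (fun θ => analyticAt_bobMatrix_mulVec y' (analyticAt_vec x y' k θ)) (θ₀ := 0) ?_ θ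
  simp only [Circle.exp_zero, bobMatrix_one, Matrix.one_mulVec]
  rw [vec_one x y', ← vec_one x y, vec_unit]
  exact one_ne_zero

lemma exists_phase [NeZero M] [Nonempty I] (hM : 16 * Fintype.card I ≤ M ^ 2) {T : ℕ}
    (hT : M ≤ T + 1) :
    ∃ ω : Circle,
      (∀ k < T, ∀ x x' y : Finset I, (∃ i, i ∈ x ↔ i ∈ x') →
        star (vec M ω x y k) ⬝ᵥ vec M ω x' y k ≠ 0) ∧
      (∀ k < T, ∀ x y y' : Finset I, star (bobMatrix M ω y *ᵥ vec M ω x y k) ⬝ᵥ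
        (bobMatrix M ω y' *ᵥ vec M ω x y' k) ≠ 0) ∧
      ∀ x y : Finset I, ¬ Disjoint x y → 2 * (x ∩ y).card ≤ Fintype.card I →
        3 / 7 < success M ω x y T := by
  have hmsg : ∀ᶠ θ in 𝓝[≠] Real.pi, ∀ k : Fin T, ∀ x x' y : Finset I, (∃ i, i ∈ x ↔ i ∈ x') →
      star (vec M (Circle.exp θ) x y k) ⬝ᵥ vec M (Circle.exp θ) x' y k ≠ 0 := by
    simp only [eventually_all]
    exact fun k x x' y h => eventually_vec_nonorthogonal h y k _
  have hreply : ∀ᶠ θ in 𝓝[≠] Real.pi, ∀ k : Fin T, ∀ x y y' : Finset I,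
      star (bobMatrix M (Circle.exp θ) y *ᵥ vec M (Circle.exp θ) x y k) ⬝ᵥ
        (bobMatrix M (Circle.exp θ) y' *ᵥ vec M (Circle.exp θ) x y' k) ≠ 0 := by
    simp only [eventually_all]
    exact fun k x y y' => eventually_bobMatrix_mulVec_nonorthogonal x y y' k _
  have hsuccess : ∀ᶠ θ in 𝓝[≠] Real.pi, ∀ x y : Finset I, ¬ Disjoint x y →
      2 * (x ∩ y).card ≤ Fintype.card I → 3 / 7 < success M (Circle.exp θ) x y T := by
    simp only [eventually_all]
    refine fun x y h0 h2 => nhdsWithin_le_nhds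
      ((continuous_success x y T).continuousAt.eventually_const_lt ?_)
    beta_reduce
    rw [show Circle.exp Real.pi = -1 from Circle.ext (by simp)]
    exact lt_of_lt_of_le (by norm_num) (le_success_neg_one hM h0 h2 hT)
  obtain ⟨θ, ⟨hmsg, hreply⟩, hsuccess⟩ := ((hmsg.and hreply).and hsuccess).exists
  exact ⟨Circle.exp θ, fun k hk => hmsg ⟨k, hk⟩, fun k hk => hreply ⟨k, hk⟩, hsuccess⟩

end Phase

/-! ### The protocol -/

section Double

variable {K : Type*}

/-- Two copies of a state, and a result bit that is still `false`. -/
def doubleVec (ψ : K → ℂ) : (K × K) × Bool → ℂ := tensorVec (tensorVec ψ ψ) (Pi.single false 1)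

/-- The operation that applies `U` to each of the two copies. -/
def doubleMatrix (U : Matrix K K ℂ) : Matrix ((K × K) × Bool) ((K × K) × Bool) ℂ :=
  (U ⊗ₖ U) ⊗ₖ (1 : Matrix Bool Bool ℂ)

variable [Fintype K]

lemma doubleMatrix_mulVec (U : Matrix K K ℂ) (ψ : K → ℂ) :
    doubleMatrix U *ᵥ doubleVec ψ = doubleVec (U *ᵥ ψ) := by
  rw [doubleMatrix, doubleVec, kronecker_mulVec_tensorVec, kronecker_mulVec_tensorVec,
    Matrix.one_mulVec, doubleVec]

lemma IsIsometry.doubleMatrix [DecidableEq K] {U : Matrix K K ℂ} (hU : IsIsometry U) :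
    IsIsometry (doubleMatrix U) :=
  (hU.kronecker hU).kronecker isIsometry_one

lemma star_doubleVec_dotProduct (ψ φ : K → ℂ) :
    star (doubleVec ψ) ⬝ᵥ doubleVec φ = (star ψ ⬝ᵥ φ) ^ 2 := by
  rw [doubleVec, doubleVec, star_tensorVec_dotProduct, star_tensorVec_dotProduct, sq]
  simp

end Double

section Scheme

variable {M q : ℕ} {I : Type} [DecidableEq I]

/-- One of the two copies holds a common element. -/
def found (y : Finset I) (w : Cell M I × Cell M I) : Bool := good y w.1 || good y w.2

variable (e : Reg q ≃ (Cell M I × Cell M I) × Bool)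

/-- Bob's last operation: if a common element has been found, flip his private qubit and the result
bit. -/
def finalPerm (y : Finset I) : Equiv.Perm (Reg 1 × Reg q) :=
  Function.Involutive.toPerm (fun z => if found y (e z.2).1 then
    (fun i => (z.1 i).rev, e.symm ((e z.2).1, !(e z.2).2)) else z) fun z => by
      by_cases h : found y (e z.2).1 <;> simp [h]

lemma finalPerm_apply (y : Finset I) (z : Reg 1 × Reg q) :
    finalPerm e y z = if found y (e z.2).1 then
      (fun i => (z.1 i).rev, e.symm ((e z.2).1, !(e z.2).2)) else z :=
  rfl

lemma finalPerm_zero_symm (y : Finset I) (w : Cell M I × Cell M I) :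
    finalPerm e y (0, e.symm (w, false)) =
      (fun _ => if found y w then 1 else 0, e.symm (w, found y w)) := by
  rw [finalPerm_apply, e.apply_symm_apply]
  cases found y w <;> rfl

variable [Fintype I] [NeZero M] [Nonempty I] {ι : Type}

/-- The search protocol: Al and Bob search for a common element of their sets in two copies of the
register in parallel, which are encoded in `q` qubits by `e`. -/
def scheme (ω : Circle) (v : ι → Finset I) :
    PingPong ι ι Bool q where
  turns := M - 1
  init x := doubleVec (initVec M (v x)) ∘ e
  init_unit x := by
    rw [star_comp_dotProduct_comp, star_doubleVec_dotProduct, star_initVec_dotProduct_initVec]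
    simp
  opAl k x := (doubleMatrix (alMatrix M k (v x))).submatrix e e
  opAl_isIsometry k x := (isIsometry_alMatrix k (v x)).doubleMatrix.submatrix e e
  opBob y := (doubleMatrix (bobMatrix M ω (v y))).submatrix e e
  opBob_isIsometry y := (isIsometry_bobMatrix ω (v y)).doubleMatrix.submatrix e e
  final y := finalPerm e (v y)
  outAl m := !(e m).2
  outBob b := decide (b 0 = 0)

variable (ω : Circle) (v : ι → Finset I)

lemma msg_scheme (x y : ι) (k : ℕ) :
    (scheme e ω v).msg x y k = doubleVec (vec M ω (v x) (v y) k) ∘ e := by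
  induction k with
  | zero => rfl
  | succ k ih =>
    rw [PingPong.msg, ih, scheme, submatrix_mulVec_comp, submatrix_mulVec_comp,
      doubleMatrix_mulVec, doubleMatrix_mulVec, vec]

lemma reply_scheme (x y : ι) (k : ℕ) :
    (scheme e ω v).reply x y k =
      doubleVec (bobMatrix M ω (v y) *ᵥ vec M ω (v x) (v y) k) ∘ e := by
  rw [PingPong.reply, msg_scheme, scheme, submatrix_mulVec_comp, doubleMatrix_mulVec]

variable {ω v}

lemma privacyLossLE_scheme [Fintype ι] [DecidableEq ι] [Nonempty ι]
    (hmsg : ∀ k < M - 1, ∀ x x' y,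
      star (vec M ω (v x) (v y) k) ⬝ᵥ vec M ω (v x') (v y) k ≠ 0)
    (hreply : ∀ k < M - 1, ∀ x y y', star (bobMatrix M ω (v y) *ᵥ vec M ω (v x) (v y) k) ⬝ᵥ
      (bobMatrix M ω (v y') *ᵥ vec M ω (v x) (v y') k) ≠ 0)
    (f : ι → ι → Bool) :
    (scheme e ω v).protocol.PrivacyLossLE f q := by
  refine PingPong.privacyLossLE_protocol (fun k hk x y y' => ?_) (fun k hk x x' y => ?_) f
  · rw [reply_scheme, reply_scheme, star_comp_dotProduct_comp, star_doubleVec_dotProduct]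
    exact pow_ne_zero 2 (hreply k hk x y y')
  · rw [msg_scheme, msg_scheme, star_comp_dotProduct_comp, star_doubleVec_dotProduct]
    exact pow_ne_zero 2 (hmsg k hk x x' y)

lemma outputProb_scheme (x y : ι) (z : Bool) :
    (scheme e ω v).protocol.outputProb x y z =
      ∑ w : Cell M I × Cell M I, if (!found (v y) w) = z then
        Complex.normSq (vec M ω (v x) (v y) (M - 1) w.1) *
          Complex.normSq (vec M ω (v x) (v y) (M - 1) w.2) else 0 := by
  rw [PingPong.outputProb_protocol, msg_scheme, ← Equiv.sum_comp e.symm, Fintype.sum_prod_type]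
  refine Finset.sum_congr rfl fun w _ => ?_
  rw [Fintype.sum_bool, scheme, finalPerm_zero_symm]
  cases found (v y) w <;> cases z <;> simp [doubleVec, tensorVec]

lemma sum_not_good (x y : Finset I) (k : ℕ) :
    ∑ s : Cell M I, (if good y s then 0 else Complex.normSq (vec M ω x y k s)) =
      1 - success M ω x y k := by
  rw [← sum_normSq_vec (M := M) ω x y k, success, ← Finset.sum_sub_distrib]
  refine Finset.sum_congr rfl fun s _ => ?_
  split_ifs <;> simp

lemma outputProb_scheme_true (x y : ι) :
    (scheme e ω v).protocol.outputProb x y true =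
      (1 - success M ω (v x) (v y) (M - 1)) ^ 2 := by
  rw [outputProb_scheme, Fintype.sum_prod_type, sq, ← sum_not_good, Finset.sum_mul_sum]
  refine Finset.sum_congr rfl fun s _ => Finset.sum_congr rfl fun t _ => ?_
  cases hs : good (v y) s <;> cases ht : good (v y) t <;> simp [found, hs, ht]

lemma outputProb_scheme_false_add_true (x y : ι) :
    (scheme e ω v).protocol.outputProb x y false +
      (scheme e ω v).protocol.outputProb x y true = 1 := by
  rw [outputProb_scheme, outputProb_scheme, ← Finset.sum_add_distrib]
  calc _ = ∑ w : Cell M I × Cell M I, Complex.normSq (vec M ω (v x) (v y) (M - 1) w.1) *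
          Complex.normSq (vec M ω (v x) (v y) (M - 1) w.2) := by
        refine Finset.sum_congr rfl fun w _ => ?_
        cases found (v y) w <;> simp
    _ = 1 := by
        rw [Fintype.sum_prod_type]
        dsimp only
        rw [← Finset.sum_mul_sum, sum_normSq_vec, one_mul]

lemma computes_scheme {f : ι → ι → Bool} (hf : ∀ x y, f x y = decide (Disjoint (v x) (v y)))
    (hsuccess : ∀ x y, ¬ Disjoint (v x) (v y) → 3 / 7 < success M ω (v x) (v y) (M - 1)) :
    (scheme e ω v).protocol.Computes f (1 / 3) := by
  intro x y
  by_cases hxy : Disjoint (v x) (v y)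
  · rw [hf, decide_eq_true hxy, outputProb_scheme_true,
      success_eq_zero hxy ω le_tsub_add]
    norm_num
  · rw [hf, decide_eq_false hxy, eq_sub_of_add_eq (outputProb_scheme_false_add_true e x y),
      outputProb_scheme_true]
    nlinarith [hsuccess x y hxy, success_le_one (M := M) ω (v x) (v y) (M - 1)]

end Scheme

lemma Protocol.PrivacyLossLE.mono {X Y Z : Type} [Fintype X] [DecidableEq X] [Fintype Y]
    [DecidableEq Y] [Fintype Z] [DecidableEq Z] {P : Protocol X Y Z} {f : X → Y → Z} {δ δ' : ℝ}
    (h : P.PrivacyLossLE f δ) (hδ : δ ≤ δ') : P.PrivacyLossLE f δ' := fun μ hμ =>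
  ⟨fun A k => ⟨fun hk hA => (((h μ hμ).1 A k).1 hk hA).trans hδ,
      fun hk hA => (((h μ hμ).1 A k).2 hk hA).trans hδ⟩,
    fun B k => ⟨fun hk hB => (((h μ hμ).2 B k).1 hk hB).trans hδ,
      fun hk hB => (((h μ hμ).2 B k).2 hk hB).trans hδ⟩⟩

lemma exists_protocol {n l : ℕ} (hn : 0 < n) (hl : 2 * n ≤ 2 ^ (2 * l)) :
    ∃ P : Protocol (Finset (Fin n)) (Finset (Fin n)) Bool,
      P.Computes (disj n) (1 / 3) ∧
      P.communication = 2 ^ (l + 2) * (6 * l + 7 + (6 * l + 7)) ∧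
      P.PrivacyLossLE (disj n) (6 * l + 7 : ℕ) := by
  set M := 2 ^ (l + 2) with hM
  set N := 2 ^ (2 * l) with hN
  have : NeZero M := ⟨by positivity⟩
  have : NeZero N := ⟨by positivity⟩
  have hMN : 16 * Fintype.card (Fin N) ≤ M ^ 2 := by
    rw [Fintype.card_fin, hM, hN]
    exact le_of_eq (by ring)
  obtain ⟨ω, hmsg, hreply, hsuccess⟩ := exists_phase hMN (le_tsub_add : M ≤ M - 1 + 1)
  have e : Reg (6 * l + 7) ≃ (Cell M (Fin N) × Cell M (Fin N)) × Bool :=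
    Fintype.equivOfCardEq <| by
      simp only [Fintype.card_pi, Fintype.card_prod, Fintype.card_fin, Fintype.card_bool,
        Finset.prod_const, Finset.card_univ, hM, hN]
      ring
  have hnN : n ≤ N := by lia
  let v : Finset (Fin n) → Finset (Fin N) := Finset.map (Fin.castLEEmb hnN)
  have hdisj : ∀ x y, Disjoint (v x) (v y) ↔ Disjoint x y := fun x y => Finset.disjoint_map _
  have houtside : ∀ x, (⟨n, by lia⟩ : Fin N) ∉ v x := fun x => by
    simp [v, Fin.ext_iff, ne_of_lt]
  have hcard : ∀ x y, 2 * (v x ∩ v y).card ≤ Fintype.card (Fin N) := fun x y => by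
    rw [← Finset.map_inter, Finset.card_map, Fintype.card_fin]
    exact (Nat.mul_le_mul_left 2 (card_finset_fin_le _)).trans hl
  refine ⟨(scheme e ω v).protocol, ?_, ?_, ?_⟩
  · refine computes_scheme e (fun x y => decide_eq_decide.2 (hdisj x y).symm) fun x y h => ?_
    exact hsuccess (v x) (v y) h (hcard x y)
  · rw [PingPong.communication_protocol, scheme, Nat.sub_add_cancel NeZero.one_le]
  · refine privacyLossLE_scheme e (fun k hk x x' y => ?_)
      (fun k hk x y y' => hreply k hk (v x) (v y) (v y')) (disj n)
    exact hmsg k hk (v x) (v x') (v y) ⟨_, iff_of_false (houtside x) (houtside x')⟩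

lemma one_le_logb_two {n : ℕ} (hn : 2 ≤ n) : 1 ≤ Real.logb 2 n := by
  rw [Real.le_logb_iff_rpow_le one_lt_two (by positivity), Real.rpow_one]
  exact_mod_cast hn

lemma exists_register_size {n : ℕ} (hn : 2 ≤ n) :
    ∃ l : ℕ, 2 * n ≤ 2 ^ (2 * l) ∧ (2 : ℝ) ^ (l + 2) ≤ 16 * √n ∧
      (6 * l + 7 : ℝ) ≤ 22 * Real.logb 2 n := by
  set a := Nat.log 2 n
  have hpow : 2 ^ (2 * (a / 2)) ≤ n :=
    (Nat.pow_le_pow_right two_pos (Nat.mul_div_le a 2)).trans (Nat.pow_log_le_self 2 (by lia))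
  refine ⟨a / 2 + 2, ?_, ?_, ?_⟩
  · calc 2 * n ≤ 2 * 2 ^ (a + 1) := by gcongr; exact (Nat.lt_pow_succ_log_self one_lt_two n).le
      _ = 2 ^ (a + 2) := by ring
      _ ≤ 2 ^ (2 * (a / 2 + 2)) := Nat.pow_le_pow_right two_pos (by lia)
  · have hsqrt : (2 : ℝ) ^ (a / 2) ≤ √n := by
      refine Real.le_sqrt_of_sq_le ?_
      rw [← pow_mul, mul_comm]
      exact_mod_cast hpow
    calc (2 : ℝ) ^ (a / 2 + 2 + 2) = 16 * 2 ^ (a / 2) := by ring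
      _ ≤ 16 * √n := by gcongr
  · have hlog : (a : ℝ) ≤ Real.logb 2 n := Real.natLog_le_logb n 2
    have hdiv : ((a / 2 : ℕ) : ℝ) ≤ a / 2 := Nat.cast_div_le
    push_cast
    linarith [one_le_logb_two hn]

end QPrivacy

end

theorem theorem1_general :
    ∃ C : ℝ, 0 ≤ C ∧ ∀ n : ℕ, 2 ≤ n →
      ∃ P : QPrivacy.Protocol (Finset (Fin n)) (Finset (Fin n)) Bool,
        P.Computes (QPrivacy.disj n) (1 / 3) ∧
        (P.communication : ℝ) ≤ C * (Real.sqrt n * Real.logb 2 n) ∧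
        P.PrivacyLossLE (QPrivacy.disj n) (C * Real.logb 2 n) := by
  refine ⟨704, by norm_num, fun n hn => ?_⟩
  obtain ⟨l, hl, hM, hq⟩ := QPrivacy.exists_register_size hn
  have hlog := QPrivacy.one_le_logb_two hn
  obtain ⟨P, hcomputes, hcomm, hprivacy⟩ := QPrivacy.exists_protocol (by lia) hl
  refine ⟨P, hcomputes, ?_, hprivacy.mono ?_⟩
  · calc (P.communication : ℝ) = 2 ^ (l + 2) * ((6 * l + 7) + (6 * l + 7)) := by
          exact_mod_cast hcomm
      _ ≤ 16 * √n * (22 * Real.logb 2 n + 22 * Real.logb 2 n) := by gcongr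
      _ = 704 * (√n * Real.logb 2 n) := by ring
  · push_cast
    linarith

theorem theorem1 :
    ∃ C : ℝ, ∀ n : ℕ, 2 ≤ n →
      ∃ P : QPrivacy.Protocol (Finset (Fin n)) (Finset (Fin n)) Bool,
        P.Computes (QPrivacy.disj n) (1 / 3) ∧
        (P.communication : ℝ) ≤ C * (Real.sqrt n * Real.logb 2 n) ∧
        P.PrivacyLossLE (QPrivacy.disj n) (C * Real.logb 2 n ^ 2) := by
  obtain ⟨C, hC, h⟩ := theorem1_general
  exact ⟨C, fun n hn => (h n hn).imp fun _ hP => ⟨hP.1, hP.2.1, hP.2.2.mono <|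
    mul_le_mul_of_nonneg_left (le_self_pow₀ (QPrivacy.one_le_logb_two hn) two_ne_zero) hC⟩⟩
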